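/- Let $\mathtt{Aff}/\mathbb{C}$ be the category of affine schemes over $\mathbb{C}$ (the opposite of the category of commutative $\mathbb{C}$-algebras), with the fpqc topology, generated by the quasi-compact jointly surjective families of flat morphisms. Let $\mathcal{D}ef$ be the lax functor (contravariant pseudofunctor) from $\mathtt{Aff}/\mathbb{C}$ to groupoids which sends $U=\mathrm{Spec}(B)$ to the groupoid of $B$-Lie algebras and isomorphisms of $B$-Lie algebras, and a morphism $f:\mathrm{Spec}(B')\to\mathrm{Spec}(B)$ to the functor $f^*\mathfrak{g}=\mathfrak{g}\otimes_B B'$, where the tensor product carries the bracket $[x\otimes s,y\otimes t]=[x,y]\otimes st$; its structure isomorphisms are the canonical ones $\mathfrak{g}\otimes_B B\simeq\mathfrak{g}$ and $\mathfrak{g}\otimes_B B''\simeq(\mathfrak{g}\otimes_B B')\otimes_{B'}B''$. Then $\mathcal{D}ef$ is a $\mathbb{C}$-stack, for the fpqc topology and for every coarser Grothendieck topology on $\mathtt{Aff}/\mathbb{C}$, in particular for the fppf, étale and Zariski topologies. That is, its values are groupoids and: 1. for every $U$ and all $\mathfrak{g},\mathfrak{h}\in\mathcal{D}ef(U)$,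 the presheaf $(f:U'\to U)\mapsto\mathrm{Hom}_{\mathcal{D}ef(U')}(f^*\mathfrak{g},f^*\mathfrak{h})$ on $(\mathtt{Aff}/\mathbb{C})/U$ is a sheaf; 2. every descent datum relative to a covering sieve is effective. In particular, for every faithfully flat morphism $f:U'\to U$ of affine $\mathbb{C}$-schemes, $\mathcal{D}ef(U)$ is equivalent, through pullback, to the category of pairs $(x',\varphi)$ of an object $x'$ of $\mathcal{D}ef(U')$ and an isomorphism $\varphi:p_1^*x'\to p_2^*x'$ over $U'\times_U U'$ with $p_{13}^*\varphi=p_{23}^*\varphi\circ p_{12}^*\varphi$ over $U'\times_U U'\times_U U'$. -/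

import Mathlib

open CategoryTheory Opposite AlgebraicGeometry Bicategory
open scoped TensorProduct

universe u

/-! ### Lie algebras over a commutative ring and base change -/

/-- A `B`-Lie algebra: a `B`-module with a `B`-bilinear alternating bracket satisfying the
Jacobi identity. -/
structure LieAlgObj (B : Type u) [CommRing B] : Type (u + 1) where
  /-- the underlying type -/
  carrier : Type u
  [lieRing : LieRing carrier]
  [lieAlgebra : LieAlgebra B carrier]

attribute [instance] LieAlgObj.lieRing LieAlgObj.lieAlgebra

namespace LieAlgObj

/-- The groupoid of `B`-Lie algebras: the morphisms are the isomorphisms of `B`-Lie algebras. -/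
instance (B : Type u) [CommRing B] : Groupoid.{u} (LieAlgObj B) where
  Hom L M := L.carrier ≃ₗ⁅B⁆ M.carrier
  id _ := LieEquiv.refl
  comp e e' := e.trans e'
  inv e := e.symm
  id_comp _ := LieEquiv.ext fun _ => rfl
  comp_id _ := LieEquiv.ext fun _ => rfl
  assoc _ _ _ := LieEquiv.ext fun _ => rfl
  inv_comp e := LieEquiv.ext fun x => LieEquiv.apply_symm_apply e x
  comp_inv e := LieEquiv.ext fun x => LieEquiv.symm_apply_apply e x

section

variable {B B' B'' : Type u} [CommRing B] [CommRing B'] [CommRing B'']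

/-- The isomorphism of Lie algebras underlying a morphism of the groupoid. -/
def lieEquiv {L M : LieAlgObj B} (e : L ⟶ M) : L.carrier ≃ₗ⁅B⁆ M.carrier := e

lemma hom_ext' {L M : LieAlgObj B} {e e' : L ⟶ M}
    (h : ∀ x, lieEquiv e x = lieEquiv e' x) : e = e' :=
  LieEquiv.ext h

@[simp] lemma lieEquiv_id (L : LieAlgObj B) (x : L.carrier) : lieEquiv (𝟙 L) x = x := rfl

@[simp] lemma lieEquiv_comp {L M N : LieAlgObj B} (e : L ⟶ M) (e' : M ⟶ N) (x : L.carrier) :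
    lieEquiv (e ≫ e') x = lieEquiv e' (lieEquiv e x) := rfl

/-- The base change `B' ⊗[B] L` of a `B`-Lie algebra `L` along a ring homomorphism `f : B → B'`,
with the current algebra bracket `⁅s ⊗ x, t ⊗ y⁆ = (s * t) ⊗ ⁅x, y⁆`. -/
noncomputable def baseChange (f : B →+* B') (L : LieAlgObj B) : LieAlgObj B' :=
  letI := f.toAlgebra
  { carrier := B' ⊗[B] L.carrier }

/-- The pure tensor `b ⊗ x` in the base change. -/
noncomputable def tmul (f : B →+* B') {L : LieAlgObj B} (b : B') (x : L.carrier) :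
    (baseChange f L).carrier :=
  letI := f.toAlgebra
  b ⊗ₜ[B] x

lemma lie_tmul (f : B →+* B') {L : LieAlgObj B} (s t : B') (x y : L.carrier) :
    ⁅tmul f s x, tmul f t y⁆ = tmul f (s * t) ⁅x, y⁆ := by
  let := f.toAlgebra
  exact LieAlgebra.ExtendScalars.bracket_tmul B B' L.carrier L.carrier s t x y

lemma smul_tmul' (f : B →+* B') {L : LieAlgObj B} (s t : B') (x : L.carrier) :
    s • tmul f t x = tmul f (s * t) x := rfl

lemma tmul_smul (f : B →+* B') {L : LieAlgObj B} (t : B') (b : B) (x : L.carrier) :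
    tmul f t (b • x) = tmul f (f b * t) x := by
  let := f.toAlgebra
  exact (TensorProduct.smul_tmul b t x).symm

lemma baseChange_induction (f : B →+* B') {L : LieAlgObj B}
    {p : (baseChange f L).carrier → Prop} (h0 : p 0) (ht : ∀ b x, p (tmul f b x))
    (ha : ∀ x y, p x → p y → p (x + y)) (z : (baseChange f L).carrier) : p z := by
  let := f.toAlgebra
  exact TensorProduct.induction_on (motive := p) z h0 ht ha

/-- A linear map out of a base change is a Lie algebra homomorphism as soon as it preserves
brackets of elements `1 ⊗ x`. -/
lemma map_lie_of_one_tmul (f : B →+* B') {L : LieAlgObj B} {M : LieAlgObj B'}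
    (φ : (baseChange f L).carrier →ₗ[B'] M.carrier)
    (h : ∀ x y : L.carrier, φ (tmul f 1 ⁅x, y⁆) = ⁅φ (tmul f 1 x), φ (tmul f 1 y)⁆)
    (z w : (baseChange f L).carrier) : φ ⁅z, w⁆ = ⁅φ z, φ w⁆ := by
  have key : ∀ (b : B') (x : L.carrier), tmul f b x = b • tmul f 1 x := fun b x => by
    rw [smul_tmul', mul_one]
  refine baseChange_induction f (p := fun z => φ ⁅z, w⁆ = ⁅φ z, φ w⁆) (by simp) (fun s x => ?_)
    (fun z z' hz hz' => by rw [add_lie, map_add, map_add, add_lie, hz, hz']) z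
  refine baseChange_induction f (p := fun w => φ ⁅tmul f s x, w⁆ = ⁅φ (tmul f s x), φ w⁆)
    (by simp) (fun t y => ?_)
    (fun z z' hz hz' => by rw [lie_add, map_add, map_add, lie_add, hz, hz']) w
  rw [lie_tmul, key s x, key t y, key (s * t), map_smul, map_smul, map_smul, h, smul_lie,
    lie_smul, smul_smul]

/-- Two morphisms out of a base change agree if they agree on all elements `1 ⊗ x`. -/
lemma baseChange_hom_ext (f : B →+* B') {L : LieAlgObj B} {M : LieAlgObj B'}
    {e e' : baseChange f L ⟶ M}
    (h : ∀ x : L.carrier, lieEquiv e (tmul f 1 x) = lieEquiv e' (tmul f 1 x)) : e = e' := by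
  refine hom_ext' fun z => ?_
  refine baseChange_induction f (p := fun z => lieEquiv e z = lieEquiv e' z)
    ((map_zero (lieEquiv e)).trans (map_zero (lieEquiv e')).symm) (fun b x => ?_)
    (fun x y hx hy => ?_) z
  · have : tmul f b x = b • tmul f 1 x := by rw [smul_tmul', mul_one]
    rw [this]
    exact ((lieEquiv e).toLinearEquiv.map_smul b _).trans
      ((congrArg (b • ·) (h x)).trans ((lieEquiv e').toLinearEquiv.map_smul b _).symm)
  · exact ((lieEquiv e).toLinearEquiv.map_add x y).trans
      ((congrArg₂ (· + ·) hx hy).trans ((lieEquiv e').toLinearEquiv.map_add x y).symm)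

/-- The isomorphism `B' ⊗[B] L ≃ B' ⊗[B] M`, `b ⊗ x ↦ b ⊗ e x`. -/
noncomputable def baseChangeMap (f : B →+* B') {L M : LieAlgObj B} (e : L ⟶ M) :
    baseChange f L ⟶ baseChange f M :=
  letI := f.toAlgebra
  letI φ : (baseChange f L).carrier ≃ₗ[B'] (baseChange f M).carrier :=
    LinearEquiv.baseChange B B' L.carrier M.carrier (lieEquiv e).toLinearEquiv
  show (baseChange f L).carrier ≃ₗ⁅B'⁆ (baseChange f M).carrier from
  { φ with
    map_lie' := fun {z w} => map_lie_of_one_tmul f φ.toLinearMap (fun x y => by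
      change tmul f 1 (lieEquiv e ⁅x, y⁆) = ⁅tmul f 1 (lieEquiv e x), tmul f 1 (lieEquiv e y)⁆
      rw [lie_tmul, mul_one, LieEquiv.map_lie]) z w }

@[simp] lemma baseChangeMap_tmul (f : B →+* B') {L M : LieAlgObj B} (e : L ⟶ M) (b : B')
    (x : L.carrier) : lieEquiv (baseChangeMap f e) (tmul f b x) = tmul f b (lieEquiv e x) := rfl

/-- The functor `L ↦ B' ⊗[B] L` from the groupoid of `B`-Lie algebras to the groupoid of
`B'`-Lie algebras. -/
noncomputable def baseChangeFunctor (f : B →+* B') : LieAlgObj B ⥤ LieAlgObj B' where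
  obj L := baseChange f L
  map e := baseChangeMap f e
  map_id _ := baseChange_hom_ext f fun _ => rfl
  map_comp _ _ := baseChange_hom_ext f fun _ => rfl

/-- The canonical isomorphism `B ⊗[B] L ≃ L`, `b ⊗ x ↦ b • x`. -/
noncomputable def baseChangeId (L : LieAlgObj B) : baseChange (RingHom.id B) L ⟶ L :=
  letI := (RingHom.id B).toAlgebra
  letI φ : (baseChange (RingHom.id B) L).carrier ≃ₗ[B] L.carrier :=
    TensorProduct.lid B L.carrier
  show (baseChange (RingHom.id B) L).carrier ≃ₗ⁅B⁆ L.carrier from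
  { φ with
    map_lie' := fun {z w} => map_lie_of_one_tmul (RingHom.id B) φ.toLinearMap (fun x y => by
      change (1 : B) • ⁅x, y⁆ = ⁅(1 : B) • x, (1 : B) • y⁆
      simp only [one_smul]) z w }

@[simp] lemma baseChangeId_tmul (L : LieAlgObj B) (b : B) (x : L.carrier) :
    lieEquiv (baseChangeId L) (tmul (RingHom.id B) b x) = b • x := rfl

/-- The canonical isomorphism `B'' ⊗[B] L ≃ B'' ⊗[B'] (B' ⊗[B] L)`, `b ⊗ x ↦ b ⊗ (1 ⊗ x)`. -/
noncomputable def baseChangeComp (f : B →+* B') (g : B' →+* B'') (L : LieAlgObj B) :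
    baseChange (g.comp f) L ⟶ baseChange g (baseChange f L) :=
  letI := f.toAlgebra
  letI := g.toAlgebra
  letI := (g.comp f).toAlgebra
  haveI : IsScalarTower B B' B'' := IsScalarTower.of_algebraMap_eq fun _ => rfl
  letI φ : (baseChange (g.comp f) L).carrier ≃ₗ[B''] (baseChange g (baseChange f L)).carrier :=
    (TensorProduct.AlgebraTensorModule.cancelBaseChange B B' B'' B'' L.carrier).symm
  show (baseChange (g.comp f) L).carrier ≃ₗ⁅B''⁆ (baseChange g (baseChange f L)).carrier from
  { φ with
    map_lie' := fun {z w} => map_lie_of_one_tmul (g.comp f) φ.toLinearMap (fun x y => by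
      change tmul g 1 (tmul f 1 ⁅x, y⁆) = ⁅tmul g 1 (tmul f 1 x), tmul g 1 (tmul f 1 y)⁆
      rw [lie_tmul, lie_tmul, mul_one, mul_one]) z w }

@[simp] lemma baseChangeComp_tmul (f : B →+* B') (g : B' →+* B'') (L : LieAlgObj B) (b : B'')
    (x : L.carrier) :
    lieEquiv (baseChangeComp f g L) (tmul (g.comp f) b x) = tmul g b (tmul f 1 x) := rfl

/-- `baseChangeId` as an isomorphism of the groupoid. -/
noncomputable def baseChangeIdIso (L : LieAlgObj B) : baseChange (RingHom.id B) L ≅ L :=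
  ⟨baseChangeId L, Groupoid.inv (baseChangeId L), Groupoid.comp_inv _, Groupoid.inv_comp _⟩

/-- `baseChangeComp` as an isomorphism of the groupoid. -/
noncomputable def baseChangeCompIso (f : B →+* B') (g : B' →+* B'') (L : LieAlgObj B) :
    baseChange (g.comp f) L ≅ baseChange g (baseChange f L) :=
  ⟨baseChangeComp f g L, Groupoid.inv (baseChangeComp f g L), Groupoid.comp_inv _,
    Groupoid.inv_comp _⟩

/-- `baseChangeId` as a natural isomorphism of functors. -/
noncomputable def baseChangeFunctorId :
    baseChangeFunctor (RingHom.id B) ≅ 𝟭 (LieAlgObj B) :=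
  NatIso.ofComponents (fun L => baseChangeIdIso L)
    (fun e => baseChange_hom_ext _ fun x => by
      change (1 : B) • lieEquiv e x = lieEquiv e ((1 : B) • x)
      simp only [one_smul])

/-- `baseChangeComp` as a natural isomorphism of functors. -/
noncomputable def baseChangeFunctorComp (f : B →+* B') (g : B' →+* B'') :
    baseChangeFunctor (g.comp f) ≅ baseChangeFunctor f ⋙ baseChangeFunctor g :=
  NatIso.ofComponents (fun L => baseChangeCompIso f g L)
    (fun _ => baseChange_hom_ext _ fun _ => rfl)

lemma baseChangeFunctor_assoc {D : Type u} [CommRing D] (f : B →+* B') (g : B' →+* B'')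
    (h : B'' →+* D) :
    (baseChangeFunctorComp (g.comp f) h).hom ≫
      Functor.whiskerRight (baseChangeFunctorComp f g).hom (baseChangeFunctor h) ≫
        (Functor.associator _ _ _).hom ≫
          Functor.whiskerLeft (baseChangeFunctor f) (baseChangeFunctorComp g h).inv ≫
            (baseChangeFunctorComp f (h.comp g)).inv =
      𝟙 (baseChangeFunctor (h.comp (g.comp f))) := by
  have key : (baseChangeFunctorComp (g.comp f) h).hom ≫
      Functor.whiskerRight (baseChangeFunctorComp f g).hom (baseChangeFunctor h) ≫
        (Functor.associator _ _ _).hom =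
      (baseChangeFunctorComp f (h.comp g)).hom ≫
        Functor.whiskerLeft (baseChangeFunctor f) (baseChangeFunctorComp g h).hom := by
    refine NatTrans.ext (funext fun L => ?_)
    exact baseChange_hom_ext (h.comp (g.comp f)) fun _ => rfl
  have key' := congrArg (· ≫ Functor.whiskerLeft (baseChangeFunctor f)
    (baseChangeFunctorComp g h).inv ≫ (baseChangeFunctorComp f (h.comp g)).inv) key
  simp only [Category.assoc] at key'
  refine key'.trans ?_
  rw [← Functor.whiskerLeft_comp_assoc, Iso.hom_inv_id, Functor.whiskerLeft_id',
    Category.id_comp, Iso.hom_inv_id]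

lemma baseChangeFunctor_id_comp (f : B →+* B') :
    (baseChangeFunctorComp (RingHom.id B) f).hom ≫
      Functor.whiskerRight baseChangeFunctorId.hom (baseChangeFunctor f) ≫
        (Functor.leftUnitor _).hom = 𝟙 (baseChangeFunctor f) := by
  refine NatTrans.ext (funext fun L => ?_)
  refine baseChange_hom_ext f fun x => ?_
  change tmul f 1 ((1 : B) • x) = tmul f 1 x
  rw [one_smul]

lemma baseChangeFunctor_comp_id (f : B →+* B') :
    (baseChangeFunctorComp f (RingHom.id B')).hom ≫
      Functor.whiskerLeft (baseChangeFunctor f) baseChangeFunctorId.hom ≫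
        (Functor.rightUnitor _).hom = 𝟙 (baseChangeFunctor f) := by
  refine NatTrans.ext (funext fun L => ?_)
  refine baseChange_hom_ext f fun x => ?_
  change (1 : B') • tmul f 1 x = tmul f 1 x
  rw [one_smul]

end

end LieAlgObj

/-! ### Affine schemes over `ℂ` and the deformation lax functor -/

/-- The category of affine schemes over `ℂ`: the opposite of the category of commutative
`ℂ`-algebras. The object `op B` is `Spec B`. -/
abbrev AffC : Type (u + 1) := (CommAlgCat.{u} ℂ)ᵒᵖ

/-- The functor which sends the affine `ℂ`-scheme `op B` to the underlying scheme `Spec B`. -/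
noncomputable def AffC.toScheme : AffC.{u} ⥤ Scheme.{u} :=
  (forget₂ (CommAlgCat.{u} ℂ) CommRingCat.{u}).op ⋙ Scheme.Spec

/-- The Grothendieck topology on affine `ℂ`-schemes generated by the families of morphisms
whose underlying families of morphisms of schemes belong to `K`. -/
noncomputable def AffC.topology (K : Precoverage Scheme.{u}) : GrothendieckTopology AffC.{u} :=
  (K.comap AffC.toScheme).toGrothendieck

/-- The fpqc topology on affine `ℂ`-schemes. -/
noncomputable def AffC.fpqcTopology : GrothendieckTopology AffC.{u} :=
  AffC.topology Scheme.fpqcPrecoverage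

/-- The fppf topology on affine `ℂ`-schemes. -/
noncomputable def AffC.fppfTopology : GrothendieckTopology AffC.{u} :=
  AffC.topology Scheme.fppfPrecoverage

/-- The étale topology on affine `ℂ`-schemes. -/
noncomputable def AffC.etaleTopology : GrothendieckTopology AffC.{u} :=
  AffC.topology Scheme.etalePrecoverage

/-- The Zariski topology on affine `ℂ`-schemes. -/
noncomputable def AffC.zariskiTopology : GrothendieckTopology AffC.{u} :=
  AffC.topology Scheme.zariskiPrecoverage

/-- The deformation lax functor: it sends `Spec B` to the groupoid of `B`-Lie algebras and their
isomorphisms, and a morphism `Spec B' ⟶ Spec B` to the base change functor `B' ⊗[B] -`; the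
structure isomorphisms are `B ⊗[B] L ≃ L` and `B'' ⊗[B] L ≃ B'' ⊗[B'] (B' ⊗[B] L)`. -/
noncomputable def deformationLaxFunctor :
    LocallyDiscrete AffC.{u}ᵒᵖ ⥤ᵖ Cat.{u, u + 1} :=
  LocallyDiscrete.mkPseudofunctor
    (fun U => Cat.of (LieAlgObj U.unop.unop))
    (fun f => (LieAlgObj.baseChangeFunctor f.unop.unop.hom.toRingHom).toCatHom)
    (fun U => Cat.Hom.isoMk (LieAlgObj.baseChangeFunctorId (B := U.unop.unop)))
    (fun f g => Cat.Hom.isoMk (LieAlgObj.baseChangeFunctorComp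
      f.unop.unop.hom.toRingHom g.unop.unop.hom.toRingHom))
    (fun f g h => Cat.Hom₂.ext (LieAlgObj.baseChangeFunctor_assoc
      f.unop.unop.hom.toRingHom g.unop.unop.hom.toRingHom h.unop.unop.hom.toRingHom))
    (fun f => Cat.Hom₂.ext (LieAlgObj.baseChangeFunctor_id_comp f.unop.unop.hom.toRingHom))
    (fun f => Cat.Hom₂.ext (LieAlgObj.baseChangeFunctor_comp_id f.unop.unop.hom.toRingHom))

/-! The core is flat descent along a finite jointly surjective family of flat maps `B → A i`.
Restricting a descent datum `(L i)` to the rings `A i ⊗[B] A j` gives coactions `φ i j : L i → A i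
⊗[B] L j`; the cocycle identity makes them coassociative and restriction to the diagonal makes them
counital. The descended object `N` is the set of families `x` with `φ i j (x i) = 1 ⊗ x j` for all
`i`, `j`, an equalizer in `∏ L i`. It is closed under the componentwise bracket because the gluing
maps are isomorphisms of Lie algebras.

Tensoring with the flat algebra `A k` preserves this equalizer and the finite product, and
coassociativity with counitality identify the result with `L k` (`counit_injective`,
`counit_surjective`). This is effectiveness. For full faithfulness, a `B`-Lie algebra `M` with
compatible isomorphisms from its base changes to the `L i` maps to `N`. That map becomes bijective
over each `A i`, hence is bijective because `∏ A i` is faithfully flat (`liftLinear_bijective`). So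
`N`, equipped with its isomorphisms to the `L i`, is determined by the datum, and morphisms descend
uniquely.

Finite jointly faithfully flat families are stable under pullback and composition, so the sieves
containing one form a topology, for which the stack property follows from the case of families.
Quasi-compactness of affine schemes shows that the fpqc topology is coarser than this one, and the
stack property passes to coarser topologies. -/

/-! ### Flat descent of modules given by coactions. -/

namespace TensorCoalgebra

variable {B : Type*} [CommRing B] {ι : Type*} {A M : ι → Type*}
  [∀ i, CommRing (A i)] [∀ i, Algebra B (A i)] [∀ i, AddCommGroup (M i)] [∀ i, Module B (M i)]
  [∀ i, Module (A i) (M i)] [∀ i, IsScalarTower B (A i) (M i)]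
  (φ : ∀ i j, M i →ₗ[A i] A i ⊗[B] M j)

/-- The two `B`-linear maps `∏ M i → ∏ A i ⊗ M j` whose equalizer is the descended module. -/
noncomputable def coaction : (∀ i, M i) →ₗ[B] (∀ p : ι × ι, A p.1 ⊗[B] M p.2) :=
  LinearMap.pi fun p => (φ p.1 p.2).restrictScalars B ∘ₗ LinearMap.proj p.1

variable (A M) in
/-- The map `(x i) ↦ (1 ⊗ x j)`. -/
noncomputable def trivialCoaction : (∀ i, M i) →ₗ[B] (∀ p : ι × ι, A p.1 ⊗[B] M p.2) :=
  LinearMap.pi fun p => TensorProduct.mk B (A p.1) (M p.2) 1 ∘ₗ LinearMap.proj p.2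

/-- The `B`-module descended from a family of coactions. -/
noncomputable def descended : Submodule B (∀ i, M i) :=
  LinearMap.eqLocus (coaction φ) (trivialCoaction A M)

lemma mem_descended {x : ∀ i, M i} :
    x ∈ descended φ ↔ ∀ i j, φ i j (x i) = 1 ⊗ₜ x j := by
  change coaction φ x = trivialCoaction A M x ↔ _
  rw [funext_iff, Prod.forall]
  rfl

variable (A) in
/-- The map `A k ⊗ N → M k`, `a ⊗ x ↦ a • x k`, for a submodule `N` of `∏ M i`. -/
noncomputable def counit (N : Submodule B (∀ i, M i)) (k : ι) : A k ⊗[B] N →ₗ[A k] M k :=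
  LinearMap.liftBaseChange (A k) (LinearMap.proj k ∘ₗ N.subtype)

variable (A) in
@[simp] lemma counit_tmul (N : Submodule B (∀ i, M i)) (k : ι) (a : A k) (x : N) :
    counit A N k (a ⊗ₜ x) = a • (x : ∀ i, M i) k := by
  simp [counit]

section

variable (k : ι)

lemma pi_tensor_ext {R : Type*} [AddCommGroup R] [Module B R] {κ : Type*} [Finite κ]
    {Q : κ → Type*} [∀ i, AddCommGroup (Q i)] [∀ i, Module B (Q i)]
    {y z : R ⊗[B] (∀ i, Q i)}
    (h : ∀ i, (LinearMap.proj i).lTensor R y = (LinearMap.proj i).lTensor R z) : y = z := by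
  classical
  have := Fintype.ofFinite κ
  refine (TensorProduct.piRight B B R Q).injective (funext fun i => ?_)
  have key : ∀ w, TensorProduct.piRight B B R Q w i = (LinearMap.proj i).lTensor R w := by
    intro w
    induction w with
    | zero => simp
    | add x y hx hy => simp only [map_add, Pi.add_apply, hx, hy]
    | tmul r q => simp
  rw [key, key, h]

lemma exists_pi_tensor [Finite ι] {R : Type*} [AddCommGroup R] [Module B R]
    {Q : ι → Type*} [∀ i, AddCommGroup (Q i)] [∀ i, Module B (Q i)] (y : ∀ i, R ⊗[B] Q i) :
    ∃ z : R ⊗[B] (∀ i, Q i), ∀ i, (LinearMap.proj i).lTensor R z = y i := by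
  classical
  have := Fintype.ofFinite ι
  obtain ⟨z, hz⟩ := (TensorProduct.piRight B B R Q).surjective y
  refine ⟨z, fun i => ?_⟩
  rw [← hz]
  clear hz
  induction z with
  | zero => simp
  | add x y hx hy => simp only [map_add, Pi.add_apply, hx, hy]
  | tmul r q => simp

/-- On `a ⊗ x` both sides are `a ⊗ x i`, by the equation defining the equalizer. Hence an element of
`A k ⊗ N` is controlled by its image in `M k`. -/
lemma proj_lTensor_descended (z : A k ⊗[B] descended φ) (i : ι) :
    (LinearMap.proj i).lTensor (A k) ((descended φ).subtype.lTensor (A k) z) =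
      φ k i (counit A _ k z) := by
  induction z with
  | zero => simp
  | add x y hx hy => simp only [map_add, hx, hy]
  | tmul a x =>
    rw [counit_tmul, map_smul, (mem_descended φ).1 x.2 k i, TensorProduct.smul_tmul']
    simp

/-- Flatness embeds `A k ⊗ N` in `A k ⊗ ∏ M i`, and every component of that embedding factors
through the counit. -/
lemma counit_injective [Finite ι] [Module.Flat B (A k)] :
    Function.Injective (counit A (descended φ) k) := by
  rw [injective_iff_map_eq_zero]
  intro z hz
  have hinj := Module.Flat.lTensor_preserves_injective_linearMap (M := A k)
    (descended φ).subtype (descended φ).injective_subtype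
  refine (injective_iff_map_eq_zero _).1 hinj z (pi_tensor_ext fun i => ?_)
  rw [proj_lTensor_descended, hz, map_zero, map_zero]

lemma counit_surjective [Finite ι] [Module.Flat B (A k)]
    (counital : ∀ x, LinearMap.liftBaseChange (A k) (LinearMap.id (R := B) (M := M k))
      (φ k k x) = x)
    (coassoc : ∀ i j (x : M k), ((φ i j).restrictScalars B).lTensor (A k) (φ k i x) =
      (TensorProduct.mk B (A i) (M j) 1).lTensor (A k) (φ k j x)) :
    Function.Surjective (counit A (descended φ) k) := by
  intro x
  -- The only possible preimage, by `proj_lTensor_descended`. Coassociativity puts it in the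
  -- equalizer of the tensored maps.
  obtain ⟨y, hy⟩ := exists_pi_tensor (fun i => φ k i x)
  have hmem : y ∈ LinearMap.eqLocus ((coaction φ).lTensor (A k))
      ((trivialCoaction A M).lTensor (A k)) := by
    refine pi_tensor_ext fun p => ?_
    simp only [← LinearMap.lTensor_comp_apply]
    have h₁ : LinearMap.proj p ∘ₗ coaction φ =
        (φ p.1 p.2).restrictScalars B ∘ₗ LinearMap.proj p.1 := rfl
    have h₂ : LinearMap.proj p ∘ₗ trivialCoaction A M =
        TensorProduct.mk B (A p.1) (M p.2) 1 ∘ₗ LinearMap.proj p.2 := rfl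
    rw [h₁, h₂, LinearMap.lTensor_comp_apply, LinearMap.lTensor_comp_apply, hy, hy, coassoc]
  -- By flatness the equalizer of the tensored maps is the image of `A k ⊗ N`.
  have h := Module.Flat.eqLocus_lTensor_eq B (A k) (coaction φ) (trivialCoaction A M)
  obtain ⟨z, hz⟩ : y ∈ LinearMap.range ((descended φ).subtype.lTensor (A k)) :=
    h.le hmem
  refine ⟨z, ?_⟩
  -- Counitality recovers `x` from the `k`-th component of `y`.
  rw [← counital x, ← hy k, ← hz]
  clear hz
  induction z with
  | zero => simp
  | add x y hx hy => simp only [map_add, hx, hy]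
  | tmul a x => simp

end

lemma bijective_of_lTensor_bijective {B : Type*} [CommRing B] {ι : Type*} [Finite ι] {A : ι → Type*}
    [∀ i, CommRing (A i)] [∀ i, Algebra B (A i)] [Module.FaithfullyFlat B (∀ i, A i)]
    {N N' : Type*} [AddCommGroup N] [Module B N] [AddCommGroup N'] [Module B N'] (g : N →ₗ[B] N')
    (h : ∀ i, Function.Bijective (g.lTensor (A i))) : Function.Bijective g := by
  classical
  have := Fintype.ofFinite ι
  rw [← Module.FaithfullyFlat.lTensor_bijective_iff_bijective B (∀ i, A i)]
  have key : ∀ z, TensorProduct.piLeft B N' A (g.lTensor (∀ i, A i) z) =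
      Pi.map (fun i => g.lTensor (A i)) (TensorProduct.piLeft B N A z) := by
    intro z
    induction z with
    | zero => ext; simp
    | add x y hx hy =>
      rw [map_add, map_add, map_add, hx, hy]
      ext; simp
    | tmul a x => ext; simp
  rw [← (TensorProduct.piLeft B N' A).bijective.of_comp_iff' (g.lTensor (∀ i, A i)),
    show ⇑(TensorProduct.piLeft B N' A) ∘ ⇑(g.lTensor (∀ i, A i)) =
      Pi.map (fun i => ⇑(g.lTensor (A i))) ∘ ⇑(TensorProduct.piLeft B N A) from funext key]
  exact (Function.Bijective.piMap h).comp (TensorProduct.piLeft B N A).bijective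

end TensorCoalgebra

/-! ### Base change of Lie algebras in terms of elements. -/

namespace LieAlgObj

section

variable {B B' B'' : Type u} [CommRing B] [CommRing B'] [CommRing B'']

lemma tmul_add (f : B →+* B') {L : LieAlgObj B} (b : B') (x y : L.carrier) :
    tmul f b (x + y) = tmul f b x + tmul f b y :=
  letI := f.toAlgebra
  TensorProduct.tmul_add b x y

lemma tmul_eq_smul (f : B →+* B') {L : LieAlgObj B} (b : B') (x : L.carrier) :
    tmul f b x = b • tmul f 1 x := by
  rw [smul_tmul', mul_one]

lemma lieEquiv_smul {L M : LieAlgObj B} (e : L ⟶ M) (b : B) (x : L.carrier) :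
    lieEquiv e (b • x) = b • lieEquiv e x :=
  (lieEquiv e).toLinearEquiv.map_smul b x

lemma lieEquiv_add {L M : LieAlgObj B} (e : L ⟶ M) (x y : L.carrier) :
    lieEquiv e (x + y) = lieEquiv e x + lieEquiv e y :=
  (lieEquiv e).toLinearEquiv.map_add x y

lemma lieEquiv_zero {L M : LieAlgObj B} (e : L ⟶ M) : lieEquiv e 0 = 0 :=
  map_zero (lieEquiv e)

lemma lieEquiv_tmul {f : B →+* B'} {L : LieAlgObj B} {M : LieAlgObj B'}
    (e : baseChange f L ⟶ M) (b : B') (x : L.carrier) :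
    lieEquiv e (tmul f b x) = b • lieEquiv e (tmul f 1 x) := by
  rw [tmul_eq_smul, lieEquiv_smul]

/-- The map `B' ⊗[B] L → B'' ⊗[B] L` induced by `g : B' → B''`. -/
noncomputable def extend {f : B →+* B'} (g : B' →+* B'') {h : B →+* B''} (hh : g.comp f = h)
    (L : LieAlgObj B) : (baseChange f L).carrier →+ (baseChange h L).carrier :=
  letI := f.toAlgebra
  letI := h.toAlgebra
  letI φ : B' →ₗ[B] B'' :=
    { g with
      map_smul' := fun b x => by
        change g (f b * x) = h b * g x
        rw [map_mul, ← hh]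
        rfl }
  (φ.rTensor L.carrier).toAddMonoidHom

@[simp] lemma extend_tmul {f : B →+* B'} (g : B' →+* B'') {h : B →+* B''} (hh : g.comp f = h)
    {L : LieAlgObj B} (b : B') (x : L.carrier) :
    extend g hh L (tmul f b x) = tmul h (g b) x := rfl

lemma extend_one_tmul {f : B →+* B'} (g : B' →+* B'') {h : B →+* B''} (hh : g.comp f = h)
    {L : LieAlgObj B} (x : L.carrier) : extend g hh L (tmul f 1 x) = tmul h 1 x := by
  rw [extend_tmul, map_one]

/-- This makes `extend` the elementwise form of the structure isomorphism of a composition. As its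
target is a base change along any `h` with `g.comp f = h`, later statements need no transport along
equalities of ring homomorphisms. -/
lemma baseChangeComp_extend (f : B →+* B') (g : B' →+* B'') {L : LieAlgObj B}
    (z : (baseChange f L).carrier) :
    lieEquiv (baseChangeComp f g L) (extend g rfl L z) = tmul g 1 z := by
  refine baseChange_induction f (p := fun z =>
    lieEquiv (baseChangeComp f g L) (extend g rfl L z) = tmul g 1 z) ?_ (fun b x => ?_)
    (fun x y hx hy => ?_) z
  · rw [map_zero, lieEquiv_zero]
    let := g.toAlgebra
    exact (TensorProduct.tmul_zero _ _).symm
  · rw [extend_tmul, baseChangeComp_tmul, tmul_eq_smul f b, tmul_smul, mul_one]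
  · rw [map_add, lieEquiv_add, hx, hy, tmul_add]

/-- Two morphisms out of an iterated base change agree if they agree on all `1 ⊗ (1 ⊗ x)`. -/
lemma baseChange_baseChange_hom_ext (f : B →+* B') (g : B' →+* B'') {L : LieAlgObj B}
    {M : LieAlgObj B''} {e e' : baseChange g (baseChange f L) ⟶ M}
    (h : ∀ x : L.carrier,
      lieEquiv e (tmul g 1 (tmul f 1 x)) = lieEquiv e' (tmul g 1 (tmul f 1 x))) : e = e' := by
  refine baseChange_hom_ext g fun y => ?_
  refine baseChange_induction f (p := fun y => lieEquiv e (tmul g 1 y) = lieEquiv e' (tmul g 1 y))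
    ?_ (fun b x => ?_) (fun x y hx hy => ?_) y
  · have : tmul g 1 (0 : (baseChange f L).carrier) = 0 :=
      letI := g.toAlgebra
      TensorProduct.tmul_zero _ _
    rw [this, lieEquiv_zero, lieEquiv_zero]
  · rw [tmul_eq_smul f b, tmul_smul, lieEquiv_tmul e, lieEquiv_tmul e', h]
  · rw [tmul_add, lieEquiv_add, lieEquiv_add, hx, hy]

/-- The identity, between tensor products formed with two equal algebra structures. -/
noncomputable def tensorCongr {i₁ i₂ : Algebra B B'} (h : i₁ = i₂) (L : LieAlgObj B) :
    (letI := i₁; B' ⊗[B] L.carrier) ≃ₗ[B'] (letI := i₂; B' ⊗[B] L.carrier) := by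
  subst h
  exact LinearEquiv.refl _ _

lemma tensorCongr_tmul {i₁ i₂ : Algebra B B'} (h : i₁ = i₂) (L : LieAlgObj B) (b : B')
    (x : L.carrier) :
    tensorCongr h L (letI := i₁; b ⊗ₜ[B] x) = (letI := i₂; b ⊗ₜ[B] x) := by
  subst h
  rfl

/-- The base change along the structure morphism of an algebra is the tensor product. -/
noncomputable def baseChangeEquiv [i : Algebra B B'] (L : LieAlgObj B) :
    (baseChange (algebraMap B B') L).carrier ≃ₗ[B'] B' ⊗[B] L.carrier :=
  -- `toAlgebra` redefines the scalar multiplication, so it agrees with a given instance only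
  -- propositionally.
  tensorCongr (i₁ := (algebraMap B B').toAlgebra) (i₂ := i)
    (Algebra.algebra_ext _ _ fun _ => rfl) L

@[simp] lemma baseChangeEquiv_tmul [Algebra B B'] (L : LieAlgObj B) (b : B') (x : L.carrier) :
    baseChangeEquiv L (tmul (algebraMap B B') b x) = b ⊗ₜ[B] x :=
  tensorCongr_tmul _ _ _ _

/-- The `B`-Lie algebra structure underlying an `A`-Lie algebra, for a `B`-algebra `A`. -/
abbrev restrictLieAlgebra (B : Type u) [CommRing B] {A : Type u} [CommRing A] [Algebra B A]
    (L : LieAlgObj A) : LieAlgebra B L.carrier where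
  __ := Module.compHom L.carrier (algebraMap B A)
  lie_smul b x y := lie_smul (algebraMap B A b) x y

lemma restrict_isScalarTower (B : Type u) [CommRing B] {A : Type u} [CommRing A] [Algebra B A]
    (L : LieAlgObj A) :
    letI := restrictLieAlgebra B L
    IsScalarTower B A L.carrier :=
  letI := restrictLieAlgebra B L
  IsScalarTower.of_algebraMap_smul fun _ _ => rfl

end

/-! ### The isomorphism `(C ⊗[B] A) ⊗[A] L ≃ C ⊗[B] L`. -/

section Cancel

attribute [local instance] restrictLieAlgebra restrict_isScalarTower

variable {B C C' A : Type u} [CommRing B] [CommRing C] [CommRing C'] [CommRing A]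
  [Algebra B C] [Algebra B C'] [Algebra B A]

variable (B C A) in
/-- The inclusion `A → C ⊗[B] A`. -/
noncomputable def inr : A →+* C ⊗[B] A :=
  (Algebra.TensorProduct.includeRight (R := B) (A := C)).toRingHom

@[simp] lemma inr_apply (a : A) : inr B C A a = 1 ⊗ₜ a := rfl

/-- The canonical isomorphism `(C ⊗[B] A) ⊗[A] L ≃ C ⊗[B] L`. -/
noncomputable def cancel (L : LieAlgObj A) :
    (baseChange (inr B C A) L).carrier ≃+ C ⊗[B] L.carrier :=
  letI := Algebra.TensorProduct.rightAlgebra (R := B) (A := C) (B := A)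
  (Algebra.IsPushout.cancelBaseChange B C A (C ⊗[B] A) L.carrier).toAddEquiv

lemma cancel_symm_tmul (L : LieAlgObj A) (c : C) (x : L.carrier) :
    (cancel (B := B) L).symm (c ⊗ₜ x) = tmul (inr B C A) (c ⊗ₜ 1) x :=
  letI := Algebra.TensorProduct.rightAlgebra (R := B) (A := C) (B := A)
  Algebra.IsPushout.cancelBaseChange_symm_tmul B C A (C ⊗[B] A) L.carrier c x

@[simp] lemma cancel_tmul (L : LieAlgObj A) (c : C) (a : A) (x : L.carrier) :
    cancel L (tmul (inr B C A) (c ⊗ₜ a) x) = c ⊗ₜ[B] (a • x) := by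
  rw [← AddEquiv.eq_symm_apply, cancel_symm_tmul, tmul_smul]
  simp

lemma cancel_one_tmul (L : LieAlgObj A) (x : L.carrier) :
    cancel L (tmul (inr B C A) 1 x) = (1 : C) ⊗ₜ[B] x := by
  rw [Algebra.TensorProduct.one_def, cancel_tmul, one_smul]

/-- The factor `a` of `(c ⊗ a) ⊗ x` moves onto `x`, so the elements `(c ⊗ 1) ⊗ x` generate
additively. -/
lemma baseChange_inr_induction {L : LieAlgObj A} {p : (baseChange (inr B C A) L).carrier → Prop}
    (h0 : p 0) (ht : ∀ (c : C) x, p (tmul (inr B C A) (c ⊗ₜ 1) x))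
    (ha : ∀ x y, p x → p y → p (x + y)) (z : (baseChange (inr B C A) L).carrier) : p z := by
  obtain ⟨w, rfl⟩ := (cancel (B := B) L).symm.surjective z
  induction w with
  | zero => rwa [map_zero]
  | add x y hx hy => rw [map_add]; exact ha _ _ hx hy
  | tmul c x => rw [cancel_symm_tmul]; exact ht c x

lemma cancel_smul (L : LieAlgObj A) (c : C) (w : (baseChange (inr B C A) L).carrier) :
    cancel L ((c ⊗ₜ[B] (1 : A) : C ⊗[B] A) • w) = c • cancel L w := by
  refine baseChange_inr_induction (p := fun w =>
    cancel L ((c ⊗ₜ[B] (1 : A) : C ⊗[B] A) • w) = c • cancel L w) ?_ (fun d x => ?_)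
    (fun x y hx hy => ?_) w
  · rw [smul_zero, map_zero, smul_zero]
  · rw [smul_tmul', Algebra.TensorProduct.tmul_mul_tmul, mul_one, cancel_tmul, cancel_tmul,
      TensorProduct.smul_tmul', smul_eq_mul]
  · rw [smul_add, map_add, map_add, smul_add, hx, hy]

/-- The isomorphism `cancel` is natural in `C`. -/
lemma cancel_extend (g : C →ₐ[B] C') (L : LieAlgObj A)
    (w : (baseChange (inr B C A) L).carrier)
    (h : (Algebra.TensorProduct.map g (AlgHom.id B A)).toRingHom.comp (inr B C A) =
      inr B C' A) :
    cancel L (extend _ h L w) = g.toLinearMap.rTensor L.carrier (cancel L w) := by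
  refine baseChange_inr_induction (p := fun w => cancel L (extend _ h L w) =
    g.toLinearMap.rTensor L.carrier (cancel L w)) ?_ (fun c x => ?_) (fun x y hx hy => ?_) w
  · rw [map_zero, map_zero, map_zero, map_zero]
  · rw [extend_tmul, cancel_tmul, LinearMap.rTensor_tmul]
    exact (congrArg (cancel L) (by simp)).trans (cancel_tmul L (g c) 1 x)
  · rw [map_add, map_add, map_add, map_add, hx, hy]

/-- The multiplication `A ⊗[B] L → L` in terms of `cancel`. -/
lemma mul_cancel (L : LieAlgObj A) (w : (baseChange (inr B A A) L).carrier)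
    (h : (Algebra.TensorProduct.lmul' (S := A) B).toRingHom.comp (inr B A A) = RingHom.id A) :
    LinearMap.liftBaseChange A (LinearMap.id (R := B) (M := L.carrier)) (cancel L w) =
      lieEquiv (baseChangeId L) (extend _ h L w) := by
  refine baseChange_inr_induction (p := fun w =>
    LinearMap.liftBaseChange A (LinearMap.id (R := B) (M := L.carrier)) (cancel L w) =
      lieEquiv (baseChangeId L) (extend _ h L w)) ?_ (fun c x => ?_) (fun x y hx hy => ?_) w
  · rw [map_zero, map_zero, map_zero, lieEquiv_zero]
  · rw [extend_tmul, cancel_tmul, baseChangeId_tmul]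
    simp
  · rw [map_add, map_add, map_add, lieEquiv_add, hx, hy]

end Cancel

end LieAlgObj

/-! ### Descent of Lie algebras over rings. -/

/-- Lie algebras over the members of a family of `B`-algebras, together with compatible
isomorphisms between their base changes to all `B`-algebras. -/
structure LieDescentDatum (B : Type u) [CommRing B] {ι : Type} (A : ι → Type u)
    [∀ i, CommRing (A i)] [∀ i, Algebra B (A i)] where
  /-- the Lie algebra over `A i` -/
  obj (i : ι) : LieAlgObj (A i)
  /-- the isomorphism between the base changes to `T` -/
  hom {T : Type u} [CommRing T] [Algebra B T] {i j : ι} (a : A i →+* T) (b : A j →+* T)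
    (ha : a.comp (algebraMap B (A i)) = algebraMap B T)
    (hb : b.comp (algebraMap B (A j)) = algebraMap B T) :
    LieAlgObj.baseChange a (obj i) ⟶ LieAlgObj.baseChange b (obj j)
  hom_extend {T T' : Type u} [CommRing T] [Algebra B T] [CommRing T'] [Algebra B T'] {i j : ι}
    (g : T →+* T') (hg : g.comp (algebraMap B T) = algebraMap B T')
    (a : A i →+* T) (b : A j →+* T)
    (ha : a.comp (algebraMap B (A i)) = algebraMap B T)
    (hb : b.comp (algebraMap B (A j)) = algebraMap B T)
    (a' : A i →+* T') (b' : A j →+* T') (ha' : g.comp a = a') (hb' : g.comp b = b')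
    (z : (LieAlgObj.baseChange a (obj i)).carrier) :
    LieAlgObj.lieEquiv (hom a' b' (by rw [← ha', RingHom.comp_assoc, ha, hg])
      (by rw [← hb', RingHom.comp_assoc, hb, hg])) (LieAlgObj.extend g ha' _ z) =
      LieAlgObj.extend g hb' _ (LieAlgObj.lieEquiv (hom a b ha hb) z)
  hom_self {T : Type u} [CommRing T] [Algebra B T] {i : ι} (a : A i →+* T)
    (ha : a.comp (algebraMap B (A i)) = algebraMap B T) : hom a a ha ha = 𝟙 _
  hom_comp {T : Type u} [CommRing T] [Algebra B T] {i j k : ι} (a : A i →+* T) (b : A j →+* T)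
    (c : A k →+* T)
    (ha : a.comp (algebraMap B (A i)) = algebraMap B T)
    (hb : b.comp (algebraMap B (A j)) = algebraMap B T)
    (hc : c.comp (algebraMap B (A k)) = algebraMap B T) :
    hom a b ha hb ≫ hom b c hb hc = hom a c ha hc

namespace LieDescentDatum

open LieAlgObj

attribute [local instance] restrictLieAlgebra restrict_isScalarTower

variable {B : Type u} [CommRing B] {ι : Type} {A : ι → Type u}
  [∀ i, CommRing (A i)] [∀ i, Algebra B (A i)] (D : LieDescentDatum B A)

section

variable {C C' E : Type u} [CommRing C] [CommRing C'] [CommRing E] [Algebra B C] [Algebra B C']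
  [Algebra B E]

variable (B C E) in
/-- The inclusion `C → C ⊗[B] E`. -/
abbrev inl : C →+* C ⊗[B] E := Algebra.TensorProduct.includeLeftRingHom

lemma toRingHom_comp_algebraMap (g : C →ₐ[B] C') :
    g.toRingHom.comp (algebraMap B C) = algebraMap B C' :=
  RingHom.ext g.commutes

lemma inl_comp_algebraMap :
    (inl B C E).comp (algebraMap B C) = algebraMap B (C ⊗[B] E) := rfl

lemma inr_comp_algebraMap :
    (inr B C E).comp (algebraMap B E) = algebraMap B (C ⊗[B] E) :=
  (Algebra.TensorProduct.includeRight (R := B) (A := C) (B := E)).comp_algebraMap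

lemma map_comp_inr (g : C →ₐ[B] C') :
    (Algebra.TensorProduct.map g (AlgHom.id B E)).toRingHom.comp (inr B C E) = inr B C' E :=
  RingHom.ext fun e => by simp [inr]

lemma lmul_comp_inr :
    (Algebra.TensorProduct.lmul' (S := E) B).toRingHom.comp (inr B E E) = RingHom.id E :=
  RingHom.ext fun e => by simp [inr]

end

/-- The isomorphism over `A i ⊗[B] A j`, as a map `obj i → A i ⊗[B] obj j`. -/
noncomputable def coact (i j : ι) : (D.obj i).carrier →ₗ[A i] A i ⊗[B] (D.obj j).carrier where
  toFun x := cancel (D.obj j) (lieEquiv (D.hom (inl B (A i) (A j)) (inr B (A i) (A j))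
    inl_comp_algebraMap inr_comp_algebraMap) (tmul _ 1 x))
  map_add' x y := by rw [tmul_add, lieEquiv_add, map_add]
  map_smul' a x := by
    rw [tmul_smul, mul_one, lieEquiv_tmul, RingHom.id_apply]
    exact cancel_smul _ _ _

lemma coact_apply (i j : ι) (x : (D.obj i).carrier) :
    D.coact i j x = cancel (D.obj j) (lieEquiv (D.hom (inl B (A i) (A j)) (inr B (A i) (A j))
      inl_comp_algebraMap inr_comp_algebraMap) (tmul _ 1 x)) := rfl

/-- Pull the gluing isomorphism back along the multiplication `A k ⊗ A k → A k`: both inclusions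
become the identity, so the isomorphism does too, by `hom_self`. -/
lemma coact_counital (k : ι) (x : (D.obj k).carrier) :
    LinearMap.liftBaseChange (A k) (LinearMap.id (R := B) (M := (D.obj k).carrier))
      (D.coact k k x) = x := by
  have h := D.hom_extend (i := k) (j := k) (Algebra.TensorProduct.lmul' (S := A k) B).toRingHom
    (toRingHom_comp_algebraMap _) (inl B (A k) (A k)) (inr B (A k) (A k)) inl_comp_algebraMap
    inr_comp_algebraMap (RingHom.id _) (RingHom.id _) (RingHom.ext fun e => by simp)
    lmul_comp_inr (tmul _ 1 x)
  rw [coact_apply, mul_cancel _ _ lmul_comp_inr, ← h, D.hom_self, lieEquiv_id, extend_one_tmul,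
    baseChangeId_tmul, one_smul]

lemma assoc_symm_tmul {C C' : Type*} [CommRing C] [CommRing C'] [Algebra B C] [Algebra B C']
    {M : Type*} [AddCommGroup M] [Module B M] (c : C) (y : C' ⊗[B] M) :
    (TensorProduct.assoc B C C' M).symm (c ⊗ₜ y) = (c ⊗ₜ[B] (1 : C')) •
      (Algebra.TensorProduct.includeRight (R := B) (A := C) (B := C')).toLinearMap.rTensor M y := by
  induction y with
  | zero => simp
  | add x y hx hy => rw [TensorProduct.tmul_add, map_add, map_add, smul_add, hx, hy]
  | tmul c' m => simp [TensorProduct.smul_tmul']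

/-- The map `id ⊗ coact j k` is the gluing isomorphism from `j` to `k` pulled back to the triple
tensor product. Linearity reduces this to `c = 1`, which is naturality along `A j ⊗ A k → (A i ⊗ A
j) ⊗ A k`. -/
lemma lTensor_coact_cancel (i j k : ι)
    (w : (baseChange (inr B (A i) (A j)) (D.obj j)).carrier) :
    (TensorProduct.assoc B (A i) (A j) (D.obj k).carrier).symm
      (((D.coact j k).restrictScalars B).lTensor (A i) (cancel _ w)) =
    cancel (D.obj k) (lieEquiv (D.hom ((inl B (A i ⊗[B] A j) (A k)).comp (inr B (A i) (A j)))
      (inr B (A i ⊗[B] A j) (A k))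
      (by rw [RingHom.comp_assoc, inr_comp_algebraMap, inl_comp_algebraMap]) inr_comp_algebraMap)
      (extend (inl B (A i ⊗[B] A j) (A k)) rfl _ w)) := by
  refine baseChange_inr_induction (p := fun w =>
    (TensorProduct.assoc B (A i) (A j) (D.obj k).carrier).symm
      (((D.coact j k).restrictScalars B).lTensor (A i) (cancel _ w)) =
    cancel (D.obj k) (lieEquiv (D.hom ((inl B (A i ⊗[B] A j) (A k)).comp (inr B (A i) (A j)))
      (inr B (A i ⊗[B] A j) (A k))
      (by rw [RingHom.comp_assoc, inr_comp_algebraMap, inl_comp_algebraMap]) inr_comp_algebraMap)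
      (extend (inl B (A i ⊗[B] A j) (A k)) rfl _ w))) ?_ (fun c x => ?_) (fun x y hx hy => ?_) w
  · rw [map_zero, map_zero, map_zero, map_zero, lieEquiv_zero, map_zero]
  · have h := D.hom_extend (i := j) (j := k) (Algebra.TensorProduct.map
        (Algebra.TensorProduct.includeRight (R := B) (A := A i) (B := A j))
        (AlgHom.id B (A k))).toRingHom
      (toRingHom_comp_algebraMap _) (inl B (A j) (A k)) (inr B (A j) (A k)) inl_comp_algebraMap
      inr_comp_algebraMap ((inl B (A i ⊗[B] A j) (A k)).comp (inr B (A i) (A j)))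
      (inr B (A i ⊗[B] A j) (A k)) (RingHom.ext fun e => by simp) (map_comp_inr _) (tmul _ 1 x)
    rw [extend_one_tmul] at h
    rw [cancel_tmul, one_smul, LinearMap.lTensor_tmul, LinearMap.restrictScalars_apply,
      coact_apply, assoc_symm_tmul, ← cancel_extend _ _ _ (map_comp_inr _), ← h, ← cancel_smul,
      extend_tmul, lieEquiv_tmul (b := inl B (A i ⊗[B] A j) (A k) (c ⊗ₜ 1))]
    rfl
  · rw [map_add, map_add, map_add, map_add, lieEquiv_add, map_add, hx, hy]

/-- This is the cocycle identity over `(A i ⊗ A j) ⊗ A k`: the left side is the gluing from `i` to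
`j` followed by that from `j` to `k`, the right side the gluing from `i` to `k`. -/
lemma coact_coassoc (i j k : ι) (x : (D.obj i).carrier) :
    ((D.coact j k).restrictScalars B).lTensor (A i) (D.coact i j x) =
      (TensorProduct.mk B (A j) (D.obj k).carrier 1).lTensor (A i) (D.coact i k x) := by
  refine (TensorProduct.assoc B (A i) (A j) (D.obj k).carrier).symm.injective ?_
  have key : ∀ y : A i ⊗[B] (D.obj k).carrier,
      (TensorProduct.assoc B (A i) (A j) (D.obj k).carrier).symm
        ((TensorProduct.mk B (A j) (D.obj k).carrier 1).lTensor (A i) y) =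
      (Algebra.TensorProduct.includeLeft (R := B) (S := B) (A := A i)
        (B := A j)).toLinearMap.rTensor (D.obj k).carrier y := fun y => by
    induction y with
    | zero => simp
    | add x y hx hy => simp only [map_add, hx, hy]
    | tmul a x => simp
  have h₁ := D.hom_extend (i := i) (j := j) (inl B (A i ⊗[B] A j) (A k)) inl_comp_algebraMap
    (inl B (A i) (A j)) (inr B (A i) (A j)) inl_comp_algebraMap inr_comp_algebraMap
    ((inl B (A i ⊗[B] A j) (A k)).comp (inl B (A i) (A j)))
    ((inl B (A i ⊗[B] A j) (A k)).comp (inr B (A i) (A j))) rfl rfl (tmul _ 1 x)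
  have h₂ := D.hom_extend (i := i) (j := k) (Algebra.TensorProduct.map
      (Algebra.TensorProduct.includeLeft (R := B) (S := B) (A := A i) (B := A j))
      (AlgHom.id B (A k))).toRingHom
    (toRingHom_comp_algebraMap _) (inl B (A i) (A k)) (inr B (A i) (A k)) inl_comp_algebraMap
    inr_comp_algebraMap ((inl B (A i ⊗[B] A j) (A k)).comp (inl B (A i) (A j)))
    (inr B (A i ⊗[B] A j) (A k)) (RingHom.ext fun e => by simp) (map_comp_inr _) (tmul _ 1 x)
  rw [extend_one_tmul] at h₁ h₂
  rw [key, coact_apply, coact_apply, lTensor_coact_cancel, ← cancel_extend _ _ _ (map_comp_inr _),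
    ← h₁, ← h₂, ← lieEquiv_comp, D.hom_comp]

/-- `x` is compatible with the descent datum over `T`. -/
lemma hom_tmul_of_mem {x : ∀ i, (D.obj i).carrier} (hx : x ∈ TensorCoalgebra.descended D.coact)
    {T : Type u} [CommRing T] [Algebra B T] {i j : ι} (a : A i →+* T) (b : A j →+* T)
    (ha : a.comp (algebraMap B (A i)) = algebraMap B T)
    (hb : b.comp (algebraMap B (A j)) = algebraMap B T) :
    lieEquiv (D.hom a b ha hb) (tmul a 1 (x i)) = tmul b 1 (x j) := by
  have h := (TensorCoalgebra.mem_descended D.coact).1 hx i j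
  rw [coact_apply, ← cancel_one_tmul, (cancel (D.obj j)).injective.eq_iff] at h
  -- The pair `(a, b)` factors through `A i ⊗ A j`, where compatibility is the definition of
  -- membership.
  let a' : A i →ₐ[B] T := { a with commutes' := fun r => congrArg (· r) ha }
  let b' : A j →ₐ[B] T := { b with commutes' := fun r => congrArg (· r) hb }
  have h₁ := D.hom_extend (i := i) (j := j) (Algebra.TensorProduct.productMap a' b').toRingHom
    (toRingHom_comp_algebraMap _) (inl B (A i) (A j)) (inr B (A i) (A j)) inl_comp_algebraMap
    inr_comp_algebraMap a b (RingHom.ext fun e => by simp [a'])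
    (RingHom.ext fun e => by simp [b', inr]) (tmul _ 1 (x i))
  rw [extend_one_tmul, h, extend_one_tmul] at h₁
  exact h₁

lemma mem_descended_of_hom {x : ∀ i, (D.obj i).carrier}
    (h : ∀ (T : Type u) [CommRing T] [Algebra B T] (i j : ι) (a : A i →+* T) (b : A j →+* T)
      (ha : a.comp (algebraMap B (A i)) = algebraMap B T)
      (hb : b.comp (algebraMap B (A j)) = algebraMap B T),
      lieEquiv (D.hom a b ha hb) (tmul a 1 (x i)) = tmul b 1 (x j)) :
    x ∈ TensorCoalgebra.descended D.coact := by
  rw [TensorCoalgebra.mem_descended]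
  intro i j
  rw [coact_apply, h, cancel_one_tmul]

/-- The Lie ring structure on a product of Lie rings. -/
abbrev piLieRing {κ : Type*} (L : κ → Type*) [∀ i, LieRing (L i)] : LieRing (∀ i, L i) where
  bracket x y := fun i => ⁅x i, y i⁆
  add_lie _ _ _ := funext fun _ => add_lie _ _ _
  lie_add _ _ _ := funext fun _ => lie_add _ _ _
  lie_self _ := funext fun _ => lie_self _
  leibniz_lie _ _ _ := funext fun _ => leibniz_lie _ _ _

attribute [local instance] piLieRing

/-- The Lie algebra structure on a product of Lie algebras. -/
abbrev piLieAlgebra (R : Type*) [CommRing R] {κ : Type*} (L : κ → Type*) [∀ i, LieRing (L i)]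
    [∀ i, LieAlgebra R (L i)] : LieAlgebra R (∀ i, L i) where
  lie_smul _ _ _ := funext fun _ => lie_smul _ _ _

attribute [local instance] piLieAlgebra

/-- The Lie algebra over `B` of compatible families of elements. -/
noncomputable def gluedSubalgebra : LieSubalgebra B (∀ i, (D.obj i).carrier) where
  __ := TensorCoalgebra.descended D.coact
  -- Gluing isomorphisms preserve brackets, and so does `x ↦ 1 ⊗ x`.
  lie_mem' {x y} hx hy := D.mem_descended_of_hom fun T _ _ i j a b ha hb => by
    have key : ∀ {i : ι} (a : A i →+* T),
        tmul a 1 (⁅x, y⁆ i) = ⁅tmul a 1 (x i), tmul a 1 (y i)⁆ := fun a => by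
      rw [lie_tmul, mul_one]; rfl
    rw [key, key, LieEquiv.map_lie, D.hom_tmul_of_mem hx, D.hom_tmul_of_mem hy]

/-- The Lie algebra obtained by descent. -/
noncomputable def glued : LieAlgObj B where
  carrier := D.gluedSubalgebra

/-- The components of an element of the descended Lie algebra. -/
noncomputable def comp (i : ι) : D.glued.carrier →ₗ[B] (D.obj i).carrier :=
  LinearMap.proj i ∘ₗ (TensorCoalgebra.descended D.coact).subtype

lemma comp_lie (i : ι) (x y : D.glued.carrier) : D.comp i ⁅x, y⁆ = ⁅D.comp i x, D.comp i y⁆ := rfl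

lemma glued_ext {x y : D.glued.carrier} (h : ∀ i, D.comp i x = D.comp i y) : x = y :=
  Subtype.ext (funext h)

lemma hom_tmul_comp (x : D.glued.carrier)
    {T : Type u} [CommRing T] [Algebra B T] {i j : ι} (a : A i →+* T) (b : A j →+* T)
    (ha : a.comp (algebraMap B (A i)) = algebraMap B T)
    (hb : b.comp (algebraMap B (A j)) = algebraMap B T) :
    lieEquiv (D.hom a b ha hb) (tmul a 1 (D.comp i x)) = tmul b 1 (D.comp j x) :=
  D.hom_tmul_of_mem x.2 a b ha hb

/-- The base change of the descended Lie algebra is the given one. -/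
noncomputable def gluedIso [Finite ι] [∀ i, Module.Flat B (A i)] (k : ι) :
    baseChange (algebraMap B (A k)) D.glued ⟶ D.obj k :=
  letI φ : (baseChange (algebraMap B (A k)) D.glued).carrier ≃ₗ[A k] (D.obj k).carrier :=
    (baseChangeEquiv D.glued).trans
      (LinearEquiv.ofBijective (TensorCoalgebra.counit A (TensorCoalgebra.descended D.coact) k)
        ⟨TensorCoalgebra.counit_injective D.coact k,
          TensorCoalgebra.counit_surjective D.coact k (D.coact_counital k)
            fun i j => D.coact_coassoc k i j⟩)
  show (baseChange (algebraMap B (A k)) D.glued).carrier ≃ₗ⁅A k⁆ (D.obj k).carrier from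
  { φ with
    map_lie' := fun {z w} => map_lie_of_one_tmul _ φ.toLinearMap (fun x y => by
      have key : ∀ x : D.glued.carrier, φ (tmul _ 1 x) = D.comp k x := fun x => by
        change TensorCoalgebra.counit A _ k (baseChangeEquiv D.glued (tmul _ 1 x)) = _
        rw [baseChangeEquiv_tmul]
        exact (TensorCoalgebra.counit_tmul A _ k 1 x).trans (one_smul _ _)
      change φ _ = ⁅φ _, φ _⁆
      rw [key, key, key, comp_lie]) z w }

@[simp] lemma gluedIso_tmul [Finite ι] [∀ i, Module.Flat B (A i)] (k : ι) (a : A k)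
    (x : D.glued.carrier) :
    lieEquiv (D.gluedIso k) (tmul _ a x) = a • D.comp k x := by
  change TensorCoalgebra.counit A _ k (baseChangeEquiv D.glued (tmul _ a x)) = _
  rw [baseChangeEquiv_tmul]
  exact TensorCoalgebra.counit_tmul A _ k a x

section Lift

variable {M : LieAlgObj B} (e : ∀ i, baseChange (algebraMap B (A i)) M ⟶ D.obj i)
  (h : ∀ (T : Type u) [CommRing T] [Algebra B T] (i j : ι) (a : A i →+* T) (b : A j →+* T)
    (ha : a.comp (algebraMap B (A i)) = algebraMap B T)
    (hb : b.comp (algebraMap B (A j)) = algebraMap B T) (x : M.carrier),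
    lieEquiv (D.hom a b ha hb) (tmul a 1 (lieEquiv (e i) (tmul _ 1 x))) =
      tmul b 1 (lieEquiv (e j) (tmul _ 1 x)))

/-- The map into the descended Lie algebra. -/
noncomputable def liftLinear : M.carrier →ₗ[B] D.glued.carrier where
  toFun x := ⟨fun i => lieEquiv (e i) (tmul _ 1 x),
    D.mem_descended_of_hom fun T _ _ i j a b ha hb => h T i j a b ha hb x⟩
  map_add' x y := D.glued_ext fun i => by
    change lieEquiv (e i) _ = lieEquiv (e i) _ + lieEquiv (e i) _
    rw [tmul_add, lieEquiv_add]
  map_smul' b x := D.glued_ext fun i => by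
    change lieEquiv (e i) _ = algebraMap B (A i) b • lieEquiv (e i) _
    rw [tmul_smul, mul_one, lieEquiv_tmul]

@[simp] lemma comp_liftLinear (i : ι) (x : M.carrier) :
    D.comp i (D.liftLinear e h x) = lieEquiv (e i) (tmul _ 1 x) := rfl

variable [Finite ι] [∀ i, Module.Flat B (A i)]

/-- After tensoring with `A i` the map becomes `e i` followed by the inverse of `gluedIso i`, an
isomorphism; faithful flatness of the product then applies. -/
lemma liftLinear_bijective [Module.FaithfullyFlat B (∀ i, A i)] :
    Function.Bijective (D.liftLinear e h) := by
  refine TensorCoalgebra.bijective_of_lTensor_bijective (A := A) _ fun i => ?_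
  have key : ∀ z : (baseChange (algebraMap B (A i)) M).carrier,
      (D.liftLinear e h).lTensor (A i) (baseChangeEquiv M z) =
        baseChangeEquiv D.glued ((lieEquiv (D.gluedIso i)).symm (lieEquiv (e i) z)) := by
    intro z
    rw [← LinearEquiv.symm_apply_eq, LieEquiv.eq_symm_apply]
    refine baseChange_induction _ (p := fun z => lieEquiv (D.gluedIso i)
      ((baseChangeEquiv D.glued).symm
        ((D.liftLinear e h).lTensor (A i) (baseChangeEquiv M z))) = lieEquiv (e i) z)
      ?_ (fun a x => ?_) (fun x y hx hy => ?_) z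
    · rw [map_zero, map_zero, map_zero, lieEquiv_zero, lieEquiv_zero]
    · rw [baseChangeEquiv_tmul, LinearMap.lTensor_tmul, ← baseChangeEquiv_tmul,
        LinearEquiv.symm_apply_apply, gluedIso_tmul, comp_liftLinear, ← lieEquiv_tmul]
    · rw [map_add, map_add, map_add, lieEquiv_add, lieEquiv_add, hx, hy]
  rw [← Function.Bijective.of_comp_iff _ (baseChangeEquiv M).bijective]
  rw [show ⇑((D.liftLinear e h).lTensor (A i)) ∘ ⇑(baseChangeEquiv M) =
    ⇑(baseChangeEquiv D.glued) ∘ ⇑(lieEquiv (D.gluedIso i)).symm ∘ ⇑(lieEquiv (e i)) from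
    funext key]
  exact (baseChangeEquiv D.glued).bijective.comp
    ((lieEquiv (D.gluedIso i)).symm.bijective.comp (lieEquiv (e i)).bijective)

/-- The isomorphism with the descended Lie algebra. -/
noncomputable def lift [Module.FaithfullyFlat B (∀ i, A i)] : M ⟶ D.glued :=
  letI φ : M.carrier ≃ₗ[B] D.glued.carrier :=
    LinearEquiv.ofBijective _ (D.liftLinear_bijective e h)
  show M.carrier ≃ₗ⁅B⁆ D.glued.carrier from
  { φ with
    map_lie' := fun {x y} => D.glued_ext fun i => by
      change lieEquiv (e i) (tmul _ 1 ⁅x, y⁆) =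
        ⁅lieEquiv (e i) (tmul _ 1 x), lieEquiv (e i) (tmul _ 1 y)⁆
      rw [← LieEquiv.map_lie, lie_tmul, mul_one] }

end Lift

end LieDescentDatum

/-! ### Structure isomorphisms of the lax functor and constant descent data, on elements. -/

namespace CategoryTheory.Pseudofunctor

open LocallyDiscreteOpToCat

variable {C : Type*} [Category* C] (F : LocallyDiscrete Cᵒᵖ ⥤ᵖ Cat)

/-- A component of the structure isomorphism for a composition. -/
def compApp {U V W : C} (g : U ⟶ V) (h : V ⟶ W) (gh : U ⟶ W) (w : g ≫ h = gh)
    (M : F.obj (.mk (op W))) :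
    (F.map gh.op.toLoc).toFunctor.obj M ⟶
      (F.map g.op.toLoc).toFunctor.obj ((F.map h.op.toLoc).toFunctor.obj M) :=
  (F.mapComp' h.op.toLoc g.op.toLoc gh.op.toLoc (by subst w; rfl)).hom.toNatTrans.app M

/-- A component of the inverse structure isomorphism for a composition. -/
def compInvApp {U V W : C} (g : U ⟶ V) (h : V ⟶ W) (gh : U ⟶ W) (w : g ≫ h = gh)
    (M : F.obj (.mk (op W))) :
    (F.map g.op.toLoc).toFunctor.obj ((F.map h.op.toLoc).toFunctor.obj M) ⟶
      (F.map gh.op.toLoc).toFunctor.obj M :=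
  (F.mapComp' h.op.toLoc g.op.toLoc gh.op.toLoc (by subst w; rfl)).inv.toNatTrans.app M

lemma compApp_eq {U V W : C} (g : U ⟶ V) (h : V ⟶ W) (M : F.obj (.mk (op W))) :
    F.compApp g h (g ≫ h) rfl M = (F.mapComp h.op.toLoc g.op.toLoc).hom.toNatTrans.app M :=
  congrArg (fun e : F.map (g ≫ h).op.toLoc ≅ F.map h.op.toLoc ≫ F.map g.op.toLoc =>
    e.hom.toNatTrans.app M) (F.mapComp'_eq_mapComp h.op.toLoc g.op.toLoc)

lemma compInvApp_eq {U V W : C} (g : U ⟶ V) (h : V ⟶ W) (M : F.obj (.mk (op W))) :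
    F.compInvApp g h (g ≫ h) rfl M = (F.mapComp h.op.toLoc g.op.toLoc).inv.toNatTrans.app M :=
  congrArg (fun e : F.map (g ≫ h).op.toLoc ≅ F.map h.op.toLoc ≫ F.map g.op.toLoc =>
    e.inv.toNatTrans.app M) (F.mapComp'_eq_mapComp h.op.toLoc g.op.toLoc)

lemma pullHom_eq_comp {V₁ V₂ U U' : C} {M₁ : F.obj (.mk (op V₁))} {M₂ : F.obj (.mk (op V₂))}
    {f₁ : U ⟶ V₁} {f₂ : U ⟶ V₂}
    (φ : (F.map f₁.op.toLoc).toFunctor.obj M₁ ⟶ (F.map f₂.op.toLoc).toFunctor.obj M₂)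
    (g : U' ⟶ U) (gf₁ : U' ⟶ V₁) (gf₂ : U' ⟶ V₂) (h₁ : g ≫ f₁ = gf₁) (h₂ : g ≫ f₂ = gf₂) :
    pullHom φ g gf₁ gf₂ h₁ h₂ = F.compApp g f₁ gf₁ h₁ M₁ ≫
      (F.map g.op.toLoc).toFunctor.map φ ≫ F.compInvApp g f₂ gf₂ h₂ M₂ := rfl

lemma ofObj_hom_eq_comp {ι : Type*} {S : C} {X : ι → C} (f : ∀ i, X i ⟶ S)
    (M : F.obj (.mk (op S))) {Y : C} (q : Y ⟶ S) {i j : ι} (a : Y ⟶ X i) (b : Y ⟶ X j)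
    (ha : a ≫ f i = q) (hb : b ≫ f j = q) :
    (DescentData.ofObj (F := F) (f := f) M).hom q a b ha hb =
      F.compInvApp a (f i) q ha M ≫ F.compApp b (f j) q hb M := rfl

end CategoryTheory.Pseudofunctor

open LieAlgObj Pseudofunctor.LocallyDiscreteOpToCat

namespace AffC

/-- The ring homomorphism underlying a morphism of affine schemes. -/
abbrev ringHom {U V : AffC.{u}} (g : U ⟶ V) : V.unop →+* U.unop := g.unop.hom.toRingHom

lemma ringHom_comp {U V W : AffC.{u}} (g : U ⟶ V) (h : V ⟶ W) {gh : U ⟶ W} (w : g ≫ h = gh) :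
    (ringHom g).comp (ringHom h) = ringHom gh := by
  subst w
  rfl

end AffC

open AffC

lemma inv_baseChangeComp_tmul {B B' B'' : Type u} [CommRing B] [CommRing B'] [CommRing B'']
    (f : B →+* B') (g : B' →+* B'') {L : LieAlgObj B} (z : (baseChange f L).carrier) :
    lieEquiv (Groupoid.inv (baseChangeComp f g L)) (tmul g 1 z) = extend g rfl L z := by
  rw [← baseChangeComp_extend f g z]
  exact LieEquiv.symm_apply_apply _ _

/-- The structure isomorphism of the deformation lax functor for a composition. -/
noncomputable def compHom {U V W : AffC.{u}} (g : U ⟶ V) (h : V ⟶ W) (gh : U ⟶ W)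
    (w : g ≫ h = gh) (L : LieAlgObj W.unop) :
    baseChange (ringHom gh) L ⟶ baseChange (ringHom g) (baseChange (ringHom h) L) :=
  deformationLaxFunctor.compApp g h gh w L

/-- The inverse structure isomorphism of the deformation lax functor for a composition. -/
noncomputable def compInv {U V W : AffC.{u}} (g : U ⟶ V) (h : V ⟶ W) (gh : U ⟶ W)
    (w : g ≫ h = gh) (L : LieAlgObj W.unop) :
    baseChange (ringHom g) (baseChange (ringHom h) L) ⟶ baseChange (ringHom gh) L :=
  deformationLaxFunctor.compInvApp g h gh w L

lemma compHom_eq {U V W : AffC.{u}} (g : U ⟶ V) (h : V ⟶ W) (L : LieAlgObj W.unop) :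
    compHom g h (g ≫ h) rfl L = baseChangeComp (ringHom h) (ringHom g) L :=
  deformationLaxFunctor.compApp_eq g h L

lemma compInv_eq {U V W : AffC.{u}} (g : U ⟶ V) (h : V ⟶ W) (L : LieAlgObj W.unop) :
    compInv g h (g ≫ h) rfl L = Groupoid.inv (baseChangeComp (ringHom h) (ringHom g) L) :=
  deformationLaxFunctor.compInvApp_eq g h L

lemma compHom_extend {U V W : AffC.{u}} (g : U ⟶ V) (h : V ⟶ W) (gh : U ⟶ W)
    (w : g ≫ h = gh) (L : LieAlgObj W.unop) (z : (baseChange (ringHom h) L).carrier) :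
    lieEquiv (compHom g h gh w L) (extend (ringHom g) (ringHom_comp g h w) L z) =
      tmul (ringHom g) 1 z := by
  subst w
  exact (congrArg (fun e : baseChange (ringHom (g ≫ h)) L ⟶
    baseChange (ringHom g) (baseChange (ringHom h) L) =>
    lieEquiv e (extend (ringHom g) (ringHom_comp g h rfl) L z)) (compHom_eq g h L)).trans
    (baseChangeComp_extend (ringHom h) (ringHom g) z)

lemma compInv_tmul {U V W : AffC.{u}} (g : U ⟶ V) (h : V ⟶ W) (gh : U ⟶ W)
    (w : g ≫ h = gh) (L : LieAlgObj W.unop) (z : (baseChange (ringHom h) L).carrier) :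
    lieEquiv (compInv g h gh w L) (tmul (ringHom g) 1 z) =
      extend (ringHom g) (ringHom_comp g h w) L z := by
  subst w
  exact (congrArg (fun e : baseChange (ringHom g) (baseChange (ringHom h) L) ⟶
      baseChange (ringHom (g ≫ h)) L => lieEquiv e (tmul (ringHom g) 1 z))
    (compInv_eq g h L)).trans (inv_baseChangeComp_tmul (ringHom h) (ringHom g) z)

lemma pullHom_eq {V₁ V₂ U U' : AffC.{u}} {L₁ : LieAlgObj V₁.unop} {L₂ : LieAlgObj V₂.unop}
    {f₁ : U ⟶ V₁} {f₂ : U ⟶ V₂} (φ : baseChange (ringHom f₁) L₁ ⟶ baseChange (ringHom f₂) L₂)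
    (g : U' ⟶ U) (gf₁ : U' ⟶ V₁) (gf₂ : U' ⟶ V₂) (h₁ : g ≫ f₁ = gf₁) (h₂ : g ≫ f₂ = gf₂) :
    (show baseChange (ringHom gf₁) L₁ ⟶ baseChange (ringHom gf₂) L₂ from
      pullHom (F := deformationLaxFunctor) (M₁ := L₁) (M₂ := L₂) φ g gf₁ gf₂ h₁ h₂) =
    compHom g f₁ gf₁ h₁ L₁ ≫ baseChangeMap (ringHom g) φ ≫ compInv g f₂ gf₂ h₂ L₂ :=
  deformationLaxFunctor.pullHom_eq_comp (M₁ := L₁) (M₂ := L₂) φ g gf₁ gf₂ h₁ h₂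


/-- The pullback of `φ` commutes with `extend`; this turns the pullback axiom of categorical descent
data into the field `hom_extend`. -/
lemma lieEquiv_pullHom_extend {V₁ V₂ U U' : AffC.{u}} {L₁ : LieAlgObj V₁.unop}
    {L₂ : LieAlgObj V₂.unop}
    {f₁ : U ⟶ V₁} {f₂ : U ⟶ V₂} (φ : baseChange (ringHom f₁) L₁ ⟶ baseChange (ringHom f₂) L₂)
    (g : U' ⟶ U) (gf₁ : U' ⟶ V₁) (gf₂ : U' ⟶ V₂) (h₁ : g ≫ f₁ = gf₁) (h₂ : g ≫ f₂ = gf₂)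
    (z : (baseChange (ringHom f₁) L₁).carrier) :
    lieEquiv (show baseChange (ringHom gf₁) L₁ ⟶ baseChange (ringHom gf₂) L₂ from
      pullHom (F := deformationLaxFunctor) (M₁ := L₁) (M₂ := L₂) φ g gf₁ gf₂ h₁ h₂)
      (extend (ringHom g) (ringHom_comp g f₁ h₁) L₁ z) =
    extend (ringHom g) (ringHom_comp g f₂ h₂) L₂ (lieEquiv φ z) := by
  rw [pullHom_eq, lieEquiv_comp, lieEquiv_comp, compHom_extend, baseChangeMap_tmul, compInv_tmul]

lemma ofObj_hom_eq {ι : Type*} {S : AffC.{u}} {X : ι → AffC.{u}} (f : ∀ i, X i ⟶ S)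
    (M : LieAlgObj S.unop) {Y : AffC.{u}} (q : Y ⟶ S) {i j : ι} (a : Y ⟶ X i) (b : Y ⟶ X j)
    (ha : a ≫ f i = q) (hb : b ≫ f j = q) :
    (show baseChange (ringHom a) (baseChange (ringHom (f i)) M) ⟶
        baseChange (ringHom b) (baseChange (ringHom (f j)) M) from
      (Pseudofunctor.DescentData.ofObj (F := deformationLaxFunctor) (f := f) M).hom q a b ha hb) =
    compInv a (f i) q ha M ≫ compHom b (f j) q hb M :=
  deformationLaxFunctor.ofObj_hom_eq_comp f M q a b ha hb


lemma lieEquiv_ofObj_hom_tmul {ι : Type*} {S : AffC.{u}} {X : ι → AffC.{u}} (f : ∀ i, X i ⟶ S)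
    (M : LieAlgObj S.unop) {Y : AffC.{u}} (q : Y ⟶ S) {i j : ι} (a : Y ⟶ X i) (b : Y ⟶ X j)
    (ha : a ≫ f i = q) (hb : b ≫ f j = q) (x : M.carrier) :
    lieEquiv (show baseChange (ringHom a) (baseChange (ringHom (f i)) M) ⟶
        baseChange (ringHom b) (baseChange (ringHom (f j)) M) from
      (Pseudofunctor.DescentData.ofObj (F := deformationLaxFunctor) (f := f) M).hom q a b ha hb)
      (tmul (ringHom a) 1 (tmul (ringHom (f i)) 1 x)) =
    tmul (ringHom b) 1 (tmul (ringHom (f j)) 1 x) := by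
  rw [ofObj_hom_eq, lieEquiv_comp, compInv_tmul, extend_one_tmul,
    ← extend_one_tmul (ringHom b) (ringHom_comp b (f j) hb), compHom_extend]

/-! ### Dictionary between descent data over affine schemes and over rings. -/

open LieAlgObj AffC Pseudofunctor.LocallyDiscreteOpToCat

namespace AffC

/-- The algebra structure given by a morphism of affine schemes. -/
abbrev homAlgebra {U V : AffC.{u}} (g : U ⟶ V) : Algebra V.unop U.unop := (ringHom g).toAlgebra

variable (S : AffC.{u}) (T : Type u) [CommRing T] [Algebra S.unop T]

/-- The `ℂ`-algebra structure on an algebra over a `ℂ`-algebra. -/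
abbrev complexAlgebra : Algebra ℂ T := ((algebraMap S.unop T).comp (algebraMap ℂ S.unop)).toAlgebra

/-- The affine `ℂ`-scheme of an algebra over the coordinate ring of `S`. -/
abbrev relSpec : AffC.{u} :=
  letI := complexAlgebra S T
  op (CommAlgCat.of ℂ T)

/-- The structure morphism of `relSpec S T`. -/
def relSpecHom : relSpec S T ⟶ S :=
  letI := complexAlgebra S T
  Quiver.Hom.op (CommAlgCat.ofHom { algebraMap S.unop T with commutes' := fun _ => rfl })

variable {S T}

/-- The morphism from `relSpec S T` to an affine scheme over `S` given by a ring homomorphism. -/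
def ofRingHom {X : AffC.{u}} (f : X ⟶ S) (a : X.unop →+* T)
    (ha : a.comp (ringHom f) = algebraMap S.unop T) : relSpec S T ⟶ X :=
  letI := complexAlgebra S T
  Quiver.Hom.op (CommAlgCat.ofHom { a with
    commutes' := fun r => by
      change a (algebraMap ℂ X.unop r) = algebraMap S.unop T (algebraMap ℂ S.unop r)
      rw [← ha, ← f.unop.hom.commutes r]
      rfl })

lemma hom_ext_ringHom {U V : AffC.{u}} {g h : U ⟶ V} (w : ∀ x, ringHom g x = ringHom h x) :
    g = h :=
  Quiver.Hom.unop_inj (CommAlgCat.hom_ext (AlgHom.ext w))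

lemma ofRingHom_comp {X : AffC.{u}} (f : X ⟶ S) (a : X.unop →+* T)
    (ha : a.comp (ringHom f) = algebraMap S.unop T) :
    ofRingHom f a ha ≫ f = relSpecHom S T :=
  hom_ext_ringHom fun x => congr($ha x)

/-- Morphisms between spectra of algebras. -/
def relSpecMap {T' : Type u} [CommRing T'] [Algebra S.unop T'] (g : T →+* T')
    (hg : g.comp (algebraMap S.unop T) = algebraMap S.unop T') : relSpec S T' ⟶ relSpec S T :=
  ofRingHom (relSpecHom S T) g hg

/-- The morphism from an affine scheme over `S` to `relSpec S T` given by a ring homomorphism. -/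
def toRelSpec {Y : AffC.{u}} (q : Y ⟶ S) (t : T →+* Y.unop)
    (ht : t.comp (algebraMap S.unop T) = ringHom q) : Y ⟶ relSpec S T :=
  letI := complexAlgebra S T
  Quiver.Hom.op (CommAlgCat.ofHom { t with
    commutes' := fun r => by
      change t (algebraMap S.unop T (algebraMap ℂ S.unop r)) = algebraMap ℂ Y.unop r
      rw [← q.unop.hom.commutes r]
      exact congr($ht _) })

end AffC

namespace CategoryTheory.Pseudofunctor.DescentData

variable {ι : Type*} {S : AffC.{u}} {X : ι → AffC.{u}} {f : ∀ i, X i ⟶ S}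

/-- The Lie algebras of a descent datum. -/
abbrev lieObj (D : deformationLaxFunctor.DescentData f) (i : ι) : LieAlgObj (X i).unop := D.obj i

/-- The isomorphisms of Lie algebras of a descent datum. -/
def lieHom (D : deformationLaxFunctor.DescentData f) {Y : AffC.{u}} (q : Y ⟶ S) {i j : ι}
    (a : Y ⟶ X i) (b : Y ⟶ X j) (ha : a ≫ f i = q) (hb : b ≫ f j = q) :
    baseChange (ringHom a) (D.lieObj i) ⟶ baseChange (ringHom b) (D.lieObj j) :=
  D.hom q a b ha hb

lemma lieHom_extend (D : deformationLaxFunctor.DescentData f) {Y Y' : AffC.{u}} (g : Y' ⟶ Y)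
    (q : Y ⟶ S) (q' : Y' ⟶ S) (hq : g ≫ q = q') {i j : ι}
    (a : Y ⟶ X i) (b : Y ⟶ X j) (ha : a ≫ f i = q) (hb : b ≫ f j = q)
    (a' : Y' ⟶ X i) (b' : Y' ⟶ X j) (ha' : g ≫ a = a') (hb' : g ≫ b = b')
    (z : (baseChange (ringHom a) (D.lieObj i)).carrier) :
    lieEquiv (D.lieHom q' a' b' (by rw [← ha', Category.assoc, ha, hq])
      (by rw [← hb', Category.assoc, hb, hq])) (extend (ringHom g) (ringHom_comp g a ha') _ z) =
      extend (ringHom g) (ringHom_comp g b hb') _ (lieEquiv (D.lieHom q a b ha hb) z) := by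
  refine Eq.trans ?_ (lieEquiv_pullHom_extend (D.lieHom q a b ha hb) g a' b' ha' hb' z)
  exact congrArg (fun e : baseChange (ringHom a') (D.lieObj i) ⟶
    baseChange (ringHom b') (D.lieObj j) => lieEquiv e (extend (ringHom g)
      (ringHom_comp g a ha') _ z)) (D.pullHom_hom g q q' hq a b ha hb a' b' ha' hb').symm

lemma lieHom_self (D : deformationLaxFunctor.DescentData f) {Y : AffC.{u}} (q : Y ⟶ S) {i : ι}
    (a : Y ⟶ X i) (ha : a ≫ f i = q) : D.lieHom q a a ha ha = 𝟙 _ :=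
  D.hom_self q a ha

lemma lieHom_comp (D : deformationLaxFunctor.DescentData f) {Y : AffC.{u}} (q : Y ⟶ S) {i j k : ι}
    (a : Y ⟶ X i) (b : Y ⟶ X j) (c : Y ⟶ X k) (ha : a ≫ f i = q) (hb : b ≫ f j = q)
    (hc : c ≫ f k = q) :
    D.lieHom q a b ha hb ≫ D.lieHom q b c hb hc = D.lieHom q a c ha hc :=
  D.hom_comp q a b c ha hb hc

end CategoryTheory.Pseudofunctor.DescentData

section

variable {ι : Type} {S : AffC.{u}} {X : ι → AffC.{u}} {f : ∀ i, X i ⟶ S}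

/-- A descent datum for the deformation lax functor, in terms of Lie algebras. -/
noncomputable def toLieDescentDatum (D : deformationLaxFunctor.DescentData f) :
    letI := fun i => homAlgebra (f i)
    LieDescentDatum S.unop (fun i => (X i).unop) :=
  letI := fun i => homAlgebra (f i)
  { obj := D.lieObj
    hom := fun {T} _ _ i j a b ha hb =>
      D.lieHom (relSpecHom S T) (ofRingHom (f i) a ha) (ofRingHom (f j) b hb)
        (ofRingHom_comp _ _ _) (ofRingHom_comp _ _ _)
    hom_extend := fun {T T'} _ _ _ _ {i j} g hg a b ha hb a' b' ha' hb' z =>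
      D.lieHom_extend (relSpecMap g hg) _ _ (ofRingHom_comp _ _ _) (ofRingHom (f i) a ha)
        (ofRingHom (f j) b hb) (ofRingHom_comp _ _ _) (ofRingHom_comp _ _ _)
        (ofRingHom (f i) a'
          (by rw [← ha', RingHom.comp_assoc]; exact (congrArg g.comp ha).trans hg))
        (ofRingHom (f j) b'
          (by rw [← hb', RingHom.comp_assoc]; exact (congrArg g.comp hb).trans hg))
        (hom_ext_ringHom fun x => congr($ha' x)) (hom_ext_ringHom fun x => congr($hb' x)) z
    hom_self := fun {T} _ _ i a ha => D.lieHom_self _ _ _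
    hom_comp := fun {T} _ _ i j k a b c ha hb hc => D.lieHom_comp _ _ _ _ _ _ _ }

end

section

variable {ι : Type} {S : AffC.{u}} {X : ι → AffC.{u}} {f : ∀ i, X i ⟶ S}

/-- The objects `Y` and `relSpec S Y.unop` have the same ring, but `ℂ`-algebra structures that are
equal only propositionally. The identity ring map gives a morphism between them, and the datum is
natural along it. -/
lemma lieHom_tmul_of_relSpec (D : deformationLaxFunctor.DescentData f) {i j : ι}
    (y : (D.lieObj i).carrier) (z : (D.lieObj j).carrier) {Y : AffC.{u}} (q : Y ⟶ S)
    (a : Y ⟶ X i) (b : Y ⟶ X j) (ha : a ≫ f i = q) (hb : b ≫ f j = q)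
    (h : letI := fun i => homAlgebra (f i)
      letI := homAlgebra q
      lieEquiv ((toLieDescentDatum D).hom (T := Y.unop) (ringHom a) (ringHom b)
        (ringHom_comp a (f i) ha) (ringHom_comp b (f j) hb)) (tmul (ringHom a) 1 y) =
          tmul (ringHom b) 1 z) :
    lieEquiv (D.lieHom q a b ha hb) (tmul (ringHom a) 1 y) = tmul (ringHom b) 1 z := by
  let := fun i => homAlgebra (f i)
  let := homAlgebra q
  have hc := D.lieHom_extend (toRelSpec q (RingHom.id Y.unop) rfl) (relSpecHom S Y.unop) q
    (hom_ext_ringHom fun _ => rfl)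
    (ofRingHom (f i) (ringHom a) (ringHom_comp a (f i) ha))
    (ofRingHom (f j) (ringHom b) (ringHom_comp b (f j) hb)) (ofRingHom_comp _ _ _)
    (ofRingHom_comp _ _ _) a b (hom_ext_ringHom fun _ => rfl) (hom_ext_ringHom fun _ => rfl)
    (tmul (ringHom a) 1 y)
  refine (congrArg _ (extend_one_tmul _ _ y).symm).trans (hc.trans ?_)
  refine (congrArg _ h).trans (extend_one_tmul _ _ z)

lemma relSpec_hom_tmul (D : deformationLaxFunctor.DescentData f) {i j : ι}
    (y : (D.lieObj i).carrier) (z : (D.lieObj j).carrier)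
    (h : ∀ {Y : AffC.{u}} (q : Y ⟶ S)
      (a : Y ⟶ X i) (b : Y ⟶ X j) (ha : a ≫ f i = q) (hb : b ≫ f j = q),
      lieEquiv (D.lieHom q a b ha hb) (tmul (ringHom a) 1 y) = tmul (ringHom b) 1 z) :
    letI := fun i => homAlgebra (f i)
    ∀ (T : Type u) [CommRing T] [Algebra S.unop T] (a : (X i).unop →+* T) (b : (X j).unop →+* T)
      (ha : a.comp (algebraMap S.unop (X i).unop) = algebraMap S.unop T)
      (hb : b.comp (algebraMap S.unop (X j).unop) = algebraMap S.unop T),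
      lieEquiv ((toLieDescentDatum D).hom a b ha hb) (tmul a 1 y) = tmul b 1 z :=
  fun T _ _ a b ha hb => h (relSpecHom S T) (ofRingHom (f i) a ha) (ofRingHom (f j) b hb)
    (ofRingHom_comp _ _ _) (ofRingHom_comp _ _ _)

end

namespace CategoryTheory.Pseudofunctor.DescentData

variable {ι : Type*} {S : AffC.{u}} {X : ι → AffC.{u}} {f : ∀ i, X i ⟶ S}

/-- The isomorphisms of Lie algebras underlying a morphism of descent data. -/
def lieMap {D₁ D₂ : deformationLaxFunctor.DescentData f} (α : D₁ ⟶ D₂) (i : ι) :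
    D₁.lieObj i ⟶ D₂.lieObj i :=
  α.hom i

lemma lieMap_comm {D₁ D₂ : deformationLaxFunctor.DescentData f} (α : D₁ ⟶ D₂) {Y : AffC.{u}}
    (q : Y ⟶ S) {i j : ι} (a : Y ⟶ X i) (b : Y ⟶ X j) (ha : a ≫ f i = q) (hb : b ≫ f j = q) :
    baseChangeMap (ringHom a) (lieMap α i) ≫ D₂.lieHom q a b ha hb =
      D₁.lieHom q a b ha hb ≫ baseChangeMap (ringHom b) (lieMap α j) :=
  α.comm q a b ha hb

/-- Isomorphisms of descent data in terms of isomorphisms of Lie algebras. -/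
noncomputable def lieIsoMk {D₁ D₂ : deformationLaxFunctor.DescentData f}
    (e : ∀ i, D₁.lieObj i ⟶ D₂.lieObj i)
    (comm : ∀ {Y : AffC.{u}} (q : Y ⟶ S) {i j : ι} (a : Y ⟶ X i) (b : Y ⟶ X j)
      (ha : a ≫ f i = q) (hb : b ≫ f j = q),
      baseChangeMap (ringHom a) (e i) ≫ D₂.lieHom q a b ha hb =
        D₁.lieHom q a b ha hb ≫ baseChangeMap (ringHom b) (e j)) : D₁ ≅ D₂ :=
  isoMk (fun i => show (D₁.lieObj i ≅ D₂.lieObj i) from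
    ⟨e i, Groupoid.inv (e i), Groupoid.comp_inv _, Groupoid.inv_comp _⟩)
    fun _ q _ _ a b ha hb => comm q a b ha hb

lemma lieHom_ofObj_tmul (M : LieAlgObj S.unop) {Y : AffC.{u}} (q : Y ⟶ S) {i j : ι} (a : Y ⟶ X i)
    (b : Y ⟶ X j) (ha : a ≫ f i = q) (hb : b ≫ f j = q) (x : M.carrier) :
    lieEquiv (show baseChange (ringHom a) (baseChange (ringHom (f i)) M) ⟶
        baseChange (ringHom b) (baseChange (ringHom (f j)) M) from
        lieHom (ofObj (F := deformationLaxFunctor) (f := f) M) q a b ha hb)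
      (tmul (ringHom a) 1 (tmul (ringHom (f i)) 1 x)) =
    tmul (ringHom b) 1 (tmul (ringHom (f j)) 1 x) :=
  lieEquiv_ofObj_hom_tmul f M q a b ha hb x

/-- The isomorphisms underlying a morphism of descent data from a constant one. -/
noncomputable def lieMapOfObj {M : LieAlgObj S.unop} {D : deformationLaxFunctor.DescentData f}
    (α : ofObj (F := deformationLaxFunctor) (f := f) M ⟶ D) (i : ι) :
    baseChange (ringHom (f i)) M ⟶ D.lieObj i :=
  lieMap α i

lemma lieHom_lieMapOfObj_tmul {M : LieAlgObj S.unop} {D : deformationLaxFunctor.DescentData f}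
    (α : ofObj (F := deformationLaxFunctor) (f := f) M ⟶ D) {Y : AffC.{u}} (q : Y ⟶ S) {i j : ι}
    (a : Y ⟶ X i) (b : Y ⟶ X j) (ha : a ≫ f i = q) (hb : b ≫ f j = q) (x : M.carrier) :
    lieEquiv (D.lieHom q a b ha hb)
        (tmul (ringHom a) 1 (lieEquiv (lieMapOfObj α i) (tmul (ringHom (f i)) 1 x))) =
      tmul (ringHom b) 1 (lieEquiv (lieMapOfObj α j) (tmul (ringHom (f j)) 1 x)) := by
  have h : baseChangeMap (ringHom a) (lieMapOfObj α i) ≫ D.lieHom q a b ha hb =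
      (show baseChange (ringHom a) (baseChange (ringHom (f i)) M) ⟶
        baseChange (ringHom b) (baseChange (ringHom (f j)) M) from
        lieHom (ofObj (F := deformationLaxFunctor) (f := f) M) q a b ha hb) ≫
        baseChangeMap (ringHom b) (lieMapOfObj α j) := lieMap_comm α q a b ha hb
  rw [← baseChangeMap_tmul, ← lieEquiv_comp, h, lieEquiv_comp, lieHom_ofObj_tmul,
    baseChangeMap_tmul]

end CategoryTheory.Pseudofunctor.DescentData

/-! ### Effective descent along finite jointly faithfully flat families. -/

namespace AffC

variable {ι : Type*} {S : AffC.{u}} {X : ι → AffC.{u}}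

/-- A family of flat morphisms which is jointly surjective. -/
def JointlyFaithfullyFlat (f : ∀ i, X i ⟶ S) : Prop :=
  (∀ i, (ringHom (f i)).Flat) ∧
    ∀ p : PrimeSpectrum S.unop, ∃ i, p ∈ Set.range (PrimeSpectrum.comap (ringHom (f i)))

/-- A finite product is a direct sum, hence flat; a prime of one factor pulls back to a prime of the
product, which gives surjectivity on spectra. -/
lemma JointlyFaithfullyFlat.faithfullyFlat_pi [Finite ι] {f : ∀ i, X i ⟶ S}
    (hf : JointlyFaithfullyFlat f) :
    letI := fun i => homAlgebra (f i)
    Module.FaithfullyFlat S.unop (∀ i, (X i).unop) := by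
  let := fun i => homAlgebra (f i)
  have : ∀ i, Module.Flat S.unop (X i).unop := hf.1
  have : Module.Flat S.unop (∀ i, (X i).unop) := by
    cases nonempty_fintype ι
    exact Module.Flat.of_linearEquiv
      (DFinsupp.linearEquivFunOnFintype (R := S.unop) (M := fun i => (X i).unop)).symm
  refine Module.FaithfullyFlat.of_comap_surjective fun p => ?_
  obtain ⟨i, q, rfl⟩ := hf.2 p
  exact ⟨PrimeSpectrum.comap (Pi.evalRingHom _ i) q, rfl⟩

end AffC

section

open Pseudofunctor.DescentData

variable {ι : Type} [Finite ι] {S : AffC.{u}} {X : ι → AffC.{u}} {f : ∀ i, X i ⟶ S}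

/-- The morphism of Lie algebras given by a morphism to a descent datum. -/
noncomputable def liftOfHom (hf : JointlyFaithfullyFlat f) {M : LieAlgObj S.unop}
    {D : deformationLaxFunctor.DescentData f}
    (α : ofObj (F := deformationLaxFunctor) (f := f) M ⟶ D) :
    letI := fun i => homAlgebra (f i)
    M ⟶ (toLieDescentDatum D).glued :=
  letI := fun i => homAlgebra (f i)
  haveI : ∀ i, Module.Flat S.unop (X i).unop := hf.1
  haveI := hf.faithfullyFlat_pi
  (toLieDescentDatum D).lift (lieMapOfObj α) fun T _ _ _ _ a b ha hb x =>
    relSpec_hom_tmul D _ _ (fun q a b ha hb => lieHom_lieMapOfObj_tmul α q a b ha hb x) T a b ha hb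

/-- `N` embeds in the Lie algebra glued from its constant descent datum, so an element of `N` is
determined by the elements `1 ⊗ y` of its base changes. -/
lemma eq_of_baseChangeMap_eq (hf : JointlyFaithfullyFlat f) {M N : LieAlgObj S.unop}
    {φ ψ : M ⟶ N} (h : ∀ i, baseChangeMap (ringHom (f i)) φ = baseChangeMap (ringHom (f i)) ψ) :
    φ = ψ := by
  refine hom_ext' fun x => ?_
  let := fun i => homAlgebra (f i)
  refine (lieEquiv (liftOfHom hf
    (𝟙 (ofObj (F := deformationLaxFunctor) (f := f) N)))).injective
      (LieDescentDatum.glued_ext _ fun i => ?_)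
  exact congrArg (lieEquiv (lieMapOfObj (𝟙 (ofObj (F := deformationLaxFunctor) (f := f) N)) i))
    (congrArg (fun e => lieEquiv e (tmul (ringHom (f i)) 1 x)) (h i))

lemma exists_baseChangeMap_eq (hf : JointlyFaithfullyFlat f) {M N : LieAlgObj S.unop}
    (α : ofObj (F := deformationLaxFunctor) (f := f) M ⟶ ofObj N) :
    ∃ φ : M ⟶ N, ∀ i, baseChangeMap (ringHom (f i)) φ = lieMap α i := by
  let := fun i => homAlgebra (f i)
  let e := liftOfHom hf (𝟙 (ofObj (F := deformationLaxFunctor) (f := f) N))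
  -- Both `M` and `N` are identified with the Lie algebra glued from the constant datum of `N`,
  -- through `α` and through the identity. The components of `e y` are the elements `1 ⊗ y`.
  refine ⟨liftOfHom hf α ≫ Groupoid.inv e, fun i => baseChange_hom_ext (ringHom (f i))
    fun x => ?_⟩
  have h : lieEquiv e (lieEquiv (liftOfHom hf α ≫ Groupoid.inv e) x) =
      lieEquiv (liftOfHom hf α) x :=
    LieEquiv.apply_symm_apply (lieEquiv e) _
  exact congrArg ((toLieDescentDatum _).comp i) h

lemma toDescentData_essSurj (hf : JointlyFaithfullyFlat f) :
    (deformationLaxFunctor.toDescentData f).EssSurj where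
  mem_essImage D := by
    let := fun i => homAlgebra (f i)
    have : ∀ i, Module.Flat S.unop (X i).unop := hf.1
    refine ⟨(toLieDescentDatum D).glued, ⟨lieIsoMk (fun i => (toLieDescentDatum D).gluedIso i) ?_⟩⟩
    intro Y q i j a b ha hb
    -- On `1 ⊗ (1 ⊗ x)` both composites give `1 ⊗ comp j x`.
    refine baseChange_baseChange_hom_ext (ringHom (f i)) (ringHom a) fun x => ?_
    have key : ∀ i, lieEquiv ((toLieDescentDatum D).gluedIso i) (tmul (ringHom (f i)) 1 x) =
      (toLieDescentDatum D).comp i x := fun i =>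
        ((toLieDescentDatum D).gluedIso_tmul i 1 x).trans (one_smul _ _)
    have h₁ := lieHom_tmul_of_relSpec D _ _ q a b ha hb
      (letI := homAlgebra q; (toLieDescentDatum D).hom_tmul_comp x (ringHom a) (ringHom b)
        (ringHom_comp a (f i) ha) (ringHom_comp b (f j) hb))
    have h₂ := lieHom_ofObj_tmul (f := f) (toLieDescentDatum D).glued q a b ha hb x
    refine (congrArg (fun z => lieEquiv (D.lieHom q a b ha hb) (tmul (ringHom a) 1 z))
      (key i)).trans (h₁.trans ?_)
    refine Eq.trans ?_ (congrArg (lieEquiv (baseChangeMap (ringHom b)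
      ((toLieDescentDatum D).gluedIso j))) h₂.symm)
    exact congrArg (tmul (ringHom b) 1) (key j).symm

/-- Lie algebras satisfy effective descent along finite jointly faithfully flat families. -/
theorem toDescentData_isEquivalence (hf : JointlyFaithfullyFlat f) :
    (deformationLaxFunctor.toDescentData f).IsEquivalence where
  faithful := ⟨fun h => eq_of_baseChangeMap_eq hf fun i => congrArg (fun α => lieMap α i) h⟩
  full := ⟨fun α => (exists_baseChangeMap_eq hf α).imp fun _ h => hom_ext h⟩
  essSurj := toDescentData_essSurj hf

end

/-! ### From finite families to the fpqc topology. -/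

namespace AffC

/-- Points with the same image in `Spec R` lift to a common point of the fibre product; hence joint
surjectivity survives base change. -/
lemma exists_comap_tensorProduct {R A B : Type u} [CommRing R] [CommRing A] [CommRing B]
    [Algebra R A] [Algebra R B] (p : PrimeSpectrum A) (q : PrimeSpectrum B)
    (h : PrimeSpectrum.comap (algebraMap R A) p = PrimeSpectrum.comap (algebraMap R B) q) :
    p ∈ Set.range (PrimeSpectrum.comap (algebraMap A (A ⊗[R] B))) := by
  obtain ⟨z, hz, -⟩ := Scheme.exists_preimage_of_isPullback
    (isPullback_SpecMap_of_isPushout _ _ _ _ (CommRingCat.isPushout_tensorProduct R A B)) p q h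
  exact ⟨z, hz⟩

section

variable {ι : Type*} {S Y : AffC.{u}} {X : ι → AffC.{u}} {f : ∀ i, X i ⟶ S}

lemma JointlyFaithfullyFlat.exists_pullback (hf : JointlyFaithfullyFlat f) (g : Y ⟶ S) :
    ∃ (P : ι → AffC.{u}) (p : ∀ i, P i ⟶ Y) (r : ∀ i, P i ⟶ X i),
      (∀ i, p i ≫ g = r i ≫ f i) ∧ JointlyFaithfullyFlat p := by
  let := homAlgebra g
  let := fun i => homAlgebra (f i)
  let r (i : ι) : relSpec Y (Y.unop ⊗[S.unop] (X i).unop) ⟶ X i :=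
    letI := complexAlgebra Y (Y.unop ⊗[S.unop] (X i).unop)
    Quiver.Hom.op (CommAlgCat.ofHom
      { (Algebra.TensorProduct.includeRight (R := S.unop) (A := Y.unop)
          (B := (X i).unop)).toRingHom with
        commutes' := fun c => by
          -- The `ℂ`-structure of the tensor product is taken through `Y`; those of `X i` and `Y`
          -- both factor through `S`.
          change (1 : Y.unop) ⊗ₜ[S.unop] (algebraMap ℂ (X i).unop c) =
            (algebraMap ℂ Y.unop c) ⊗ₜ[S.unop] 1
          rw [← g.unop.hom.commutes c, ← (f i).unop.hom.commutes c]
          exact ((Algebra.TensorProduct.includeRight (R := S.unop) (A := Y.unop)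
            (B := (X i).unop)).commutes _).trans rfl })
  refine ⟨fun i => relSpec Y (Y.unop ⊗[S.unop] (X i).unop), fun i => relSpecHom Y _, r,
    fun i => hom_ext_ringHom fun x => ?_, fun i => ?_, fun p => ?_⟩
  · exact ((Algebra.TensorProduct.includeRight (R := S.unop) (A := Y.unop)
      (B := (X i).unop)).commutes x).symm
  · have : Module.Flat S.unop (X i).unop := hf.1 i
    have h : Module.Flat Y.unop (Y.unop ⊗[S.unop] (X i).unop) := inferInstance
    exact (RingHom.flat_algebraMap_iff (R := Y.unop) (S := Y.unop ⊗[S.unop] (X i).unop)).2 h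
  · obtain ⟨i, q, hq⟩ := hf.2 (PrimeSpectrum.comap (ringHom g) p)
    exact ⟨i, exists_comap_tensorProduct p q hq.symm⟩

lemma JointlyFaithfullyFlat.sigma (hf : JointlyFaithfullyFlat f) {κ : ι → Type*}
    {Z : ∀ i, κ i → AffC.{u}} {g : ∀ i j, Z i j ⟶ X i}
    (hg : ∀ i, JointlyFaithfullyFlat (g i)) :
    JointlyFaithfullyFlat (fun x : Σ i, κ i => g x.1 x.2 ≫ f x.1) := by
  refine ⟨fun x => (hf.1 x.1).comp ((hg x.1).1 x.2), fun p => ?_⟩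
  obtain ⟨i, q, rfl⟩ := hf.2 p
  obtain ⟨j, r, rfl⟩ := (hg i).2 q
  exact ⟨⟨i, j⟩, r, rfl⟩

lemma jointlyFaithfullyFlat_id (S : AffC.{u}) :
    JointlyFaithfullyFlat (fun _ : Unit => 𝟙 S) :=
  ⟨fun _ => RingHom.Flat.id _, fun p => ⟨(), p, rfl⟩⟩

lemma jointlyFaithfullyFlat_of_faithfullyFlat {U U' : AffC.{u}} {f : U' ⟶ U}
    (hf : (ringHom f).FaithfullyFlat) : JointlyFaithfullyFlat (fun _ : Unit => f) := by
  rw [RingHom.FaithfullyFlat.iff_flat_and_comap_surjective] at hf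
  exact ⟨fun _ => hf.1, fun p => ⟨(), hf.2 p⟩⟩

end

/-- The topology whose covering sieves are those which contain a finite jointly faithfully flat
family. -/
def finiteFlatTopology : GrothendieckTopology AffC.{u} where
  sieves S := {R | ∃ (ι : Type) (_ : Finite ι) (X : ι → AffC.{u}) (f : ∀ i, X i ⟶ S),
    JointlyFaithfullyFlat f ∧ ∀ i, R (f i)}
  top_mem' S := ⟨Unit, inferInstance, _, _, jointlyFaithfullyFlat_id S, fun _ => trivial⟩
  pullback_stable' := by
    rintro S Y R g ⟨ι, _, X, f, hf, hR⟩
    obtain ⟨P, p, r, w, hp⟩ := hf.exists_pullback g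
    refine ⟨ι, inferInstance, P, p, hp, fun i => ?_⟩
    change R (p i ≫ g)
    rw [w i]
    exact R.downward_closed (hR i) _
  transitive' := by
    rintro S R ⟨ι, _, X, f, hf, hR⟩ R' h
    choose κ _ Z g hg hR' using fun i => h (hR i)
    exact ⟨Σ i, κ i, inferInstance, _, _, hf.sigma hg, fun x => hR' x.1 x.2⟩

lemma mem_finiteFlatTopology {S : AffC.{u}} {R : Sieve S} : R ∈ finiteFlatTopology S ↔
    ∃ (ι : Type) (_ : Finite ι) (X : ι → AffC.{u}) (f : ∀ i, X i ⟶ S),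
      JointlyFaithfullyFlat f ∧ ∀ i, R (f i) := Iff.rfl

end AffC

section

variable {ι : Type} [Finite ι] {S : AffC.{u}} {X : ι → AffC.{u}} {f : ∀ i, X i ⟶ S}

lemma isStackFor_ofArrows (hf : JointlyFaithfullyFlat f) :
    deformationLaxFunctor.IsStackFor (Presieve.ofArrows X f) :=
  (Pseudofunctor.isStackFor_ofArrows_iff _ _).2 (toDescentData_isEquivalence hf)

lemma isPrestackFor_sieveOfArrows (hf : JointlyFaithfullyFlat f) :
    deformationLaxFunctor.IsPrestackFor (Sieve.ofArrows X f).arrows :=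
  (Pseudofunctor.IsPrestackFor_generate_iff _ _).2 (isStackFor_ofArrows hf).isPrestackFor

/-- The pulled-back sieve contains the one generated by the pulled-back family, for which the Hom
presheaf is a sheaf; separatedness passes to larger sieves. -/
lemma isSeparatedFor_pullback_sieveOfArrows (hf : JointlyFaithfullyFlat f)
    (M N : deformationLaxFunctor.obj (.mk (op S))) {Y : Over S} (g : Y ⟶ Over.mk (𝟙 S)) :
    Presieve.IsSeparatedFor (deformationLaxFunctor.presheafHom M N)
      (((Sieve.overEquiv (Over.mk (𝟙 S))).symm (Sieve.ofArrows X f)).pullback g).arrows := by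
  obtain ⟨P, p, r, w, hp⟩ := hf.exists_pullback Y.hom
  have hs : Presieve.IsSheafFor (deformationLaxFunctor.presheafHom M N)
      ((Sieve.overEquiv Y).symm (Sieve.ofArrows P p)).arrows := by
    refine Pseudofunctor.IsPrestackFor.isSheafFor' Y ?_ M N
    rw [OrderIso.apply_symm_apply]
    exact isPrestackFor_sieveOfArrows hp
  have hle : ((Sieve.overEquiv Y).symm (Sieve.ofArrows P p)) ≤
      ((Sieve.overEquiv (Over.mk (𝟙 S))).symm (Sieve.ofArrows X f)).pullback g := by
    intro Z h hh
    rw [Sieve.overEquiv_symm_iff] at hh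
    rw [Sieve.pullback_apply, Sieve.overEquiv_symm_iff, Over.comp_left]
    have hg : g.left = Y.hom := (Category.comp_id _).symm.trans (Over.w g)
    obtain ⟨_, a, _, ⟨i⟩, ha⟩ := hh
    rw [← ha, hg, Category.assoc, w i]
    exact ⟨_, a ≫ r i, _, ⟨i⟩, Category.assoc _ _ _⟩
  intro x t₁ t₂ h₁ h₂
  exact hs.isSeparatedFor _ _ _ (Presieve.isAmalgamation_restrict hle x t₁ h₁)
    (Presieve.isAmalgamation_restrict hle x t₂ h₂)

end

instance isPrestack_finiteFlatTopology :
    deformationLaxFunctor.{u}.IsPrestack finiteFlatTopology :=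
  .of_isPrestackFor fun S R ⟨ι, _, X, f, hf, hR⟩ => by
    rw [Pseudofunctor.isPrestackFor_iff_isSheafFor]
    intro M N
    -- `R` merely contains the sieve of the finite family: the sheaf condition for the latter, with
    -- separatedness for its pullbacks, gives it for `R`.
    refine Presieve.isSheafFor_subsieve_aux _
      (S := (Sieve.overEquiv (Over.mk (𝟙 S))).symm (Sieve.ofArrows X f)) ?_ ?_ ?_
    · refine (Sieve.overEquiv (Over.mk (𝟙 S))).symm.monotone ?_
      rw [Sieve.ofArrows, Sieve.generate_le_iff]
      rintro _ _ ⟨i⟩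
      exact hR i
    · exact (Pseudofunctor.isPrestackFor_iff_isSheafFor _ _).1 (isPrestackFor_sieveOfArrows hf) M N
    · exact fun Y g _ => isSeparatedFor_pullback_sieveOfArrows hf M N g

/-- Lie algebras form a stack for the topology of finite jointly faithfully flat families. -/
theorem isStack_finiteFlatTopology : deformationLaxFunctor.{u}.IsStack finiteFlatTopology :=
  .of_isStackFor fun S R ⟨ι, _, X, f, hf, hR⟩ => by
    refine (isStackFor_ofArrows hf).of_le (J := finiteFlatTopology) _
      ⟨ι, inferInstance, X, f, hf, fun i => Sieve.le_generate _ _ _ ⟨i⟩⟩ ?_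
    rintro _ _ ⟨i⟩
    exact hR i

lemma isStack_of_le {C : Type*} [Category* C] {F : LocallyDiscrete Cᵒᵖ ⥤ᵖ Cat}
    {J K : GrothendieckTopology C} (h : J ≤ K) [F.IsStack K] : F.IsStack J :=
  .of_isStackFor fun S R hR => F.isStackFor' (J := K) R (h S hR)

lemma AffC.fpqcTopology_le_finiteFlatTopology : fpqcTopology.{u} ≤ finiteFlatTopology := by
  rw [fpqcTopology, AffC.topology, Precoverage.toGrothendieck_eq_sInf]
  refine sInf_le fun S R hR => ?_
  obtain ⟨ι, X, f, rfl⟩ := R.exists_eq_ofArrows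
  rw [Precoverage.mem_comap_iff, Presieve.map_ofArrows] at hR
  obtain ⟨hqc, hflat⟩ := hR
  replace hflat := (Scheme.ofArrows_mem_precoverage_iff _).1 hflat
  let E : PreZeroHypercover (toScheme.obj S) :=
    { I₀ := ι, X := fun i => toScheme.obj (X i), f := fun i => toScheme.map (f i) }
  have : QuasiCompactCover E := Scheme.presieve₀_mem_qcPrecoverage_iff.1 hqc
  -- Finitely many affine opens `V k` of members `X (a k)` already cover the affine base; the whole
  -- members `X (a k)` then form the required finite family, indexed by `Fin n`.
  obtain ⟨n, a, V, -, hV⟩ := QuasiCompactCover.exists_isAffineOpen_of_isCompact E (U := ⊤)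
    (show IsCompact (Set.univ : Set (PrimeSpectrum S.unop)) from isCompact_univ)
  refine mem_finiteFlatTopology.2 ⟨Fin n, inferInstance, _, fun k => f (a k), ⟨fun k => ?_,
    fun p => ?_⟩, fun k => Sieve.le_generate _ _ _ ⟨a k⟩⟩
  · exact Flat.SpecMap_iff.1 (hflat.2 (a k))
  · have hp : p ∈ ⋃ i, E.f (a i) '' (V i) := hV.symm ▸ trivial
    obtain ⟨k, q, -, hq⟩ := Set.mem_iUnion.1 hp
    exact ⟨k, q, hq⟩

lemma isStack_of_le_fpqcTopology {J : GrothendieckTopology AffC.{u}} (h : J ≤ fpqcTopology) :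
    deformationLaxFunctor.{u}.IsStack J :=
  haveI := isStack_finiteFlatTopology.{u}
  isStack_of_le (h.trans fpqcTopology_le_finiteFlatTopology)

lemma AffC.topology_mono {K K' : Precoverage Scheme.{u}} (h : K ≤ K') :
    AffC.topology K ≤ AffC.topology K' :=
  Precoverage.toGrothendieck_mono (Precoverage.comap_monotone h)

theorem theorem2 :
    -- the values of the lax functor are groupoids
    (∀ U : AffC.{u}, IsGroupoid (deformationLaxFunctor.{u}.obj (.mk (op U)))) ∧
    -- it is a stack (Hom presheaves are sheaves, descent data are effective) for the fpqc
    -- topology and for every coarser topology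
    (∀ J : GrothendieckTopology AffC.{u}, J ≤ AffC.fpqcTopology →
      deformationLaxFunctor.{u}.IsStack J) ∧
    -- in particular for the three other classical topologies
    deformationLaxFunctor.{u}.IsStack AffC.fppfTopology ∧
    deformationLaxFunctor.{u}.IsStack AffC.etaleTopology ∧
    deformationLaxFunctor.{u}.IsStack AffC.zariskiTopology ∧
    -- for a faithfully flat morphism `f : U' ⟶ U` the groupoid over `U` is equivalent to the
    -- category of pairs of an object over `U'` and a gluing isomorphism over `U' ×[U] U'` which
    -- satisfies the cocycle identity over `U' ×[U] U' ×[U] U'`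
    (∀ (U U' : AffC.{u}) (f : U' ⟶ U), f.unop.hom.toRingHom.FaithfullyFlat →
      ∀ (sq : ∀ _ _ : Unit, Limits.ChosenPullback f f)
        (sq₃ : ∀ i j k : Unit, Limits.ChosenPullback₃ (sq i j) (sq j k) (sq i k)),
        (deformationLaxFunctor.{u}.toDescentData (fun _ : Unit => f) ⋙
          Pseudofunctor.DescentData'.fromDescentDataFunctor
            deformationLaxFunctor.{u} sq sq₃).IsEquivalence) := by
  refine ⟨fun U => inferInstanceAs (IsGroupoid (LieAlgObj U.unop)),
    fun J hJ => isStack_of_le_fpqcTopology hJ,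
    isStack_of_le_fpqcTopology (topology_mono Scheme.fppfPrecoverage_le_fpqcPrecoverage),
    isStack_of_le_fpqcTopology (topology_mono
      (Scheme.etalePrecoverage_le_proetalePrecoverage.trans
        Scheme.proetalePrecoverage_le_fpqcPrecoverage)),
    isStack_of_le_fpqcTopology (topology_mono Scheme.zariskiPrecoverage_le_fpqcPrecoverage),
    fun U U' f hf sq sq₃ => ?_⟩
  -- The functor is a composite of two equivalences: descent along the one-member family, and
  -- passage from gluing over all test objects to gluing over the chosen fibre products.
  have := toDescentData_isEquivalence (jointlyFaithfullyFlat_of_faithfullyFlat hf)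
  have : (Pseudofunctor.DescentData'.fromDescentDataFunctor
      deformationLaxFunctor.{u} sq sq₃).IsEquivalence :=
    (Pseudofunctor.DescentData'.descentDataEquivalence
      deformationLaxFunctor.{u} sq sq₃).isEquivalence_inverse
  infer_instance
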